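/- Let $n\ge 1$, $m>0$, and use the metric of signature $(+,-,\dots,-)$, so that spatial indices are lowered by $x_j=-x^j$ and $p_kx^k=-\mathbf p\cdot\mathbf x$. Put $\omega_{\mathbf p}=\sqrt{|\mathbf p|^2+m^2}$ and $d^n\mu(\mathbf p)=d^n\mathbf p/(2\omega_{\mathbf p})$. Let $\mathscr F^+$ be the Bosonic Fock space, the Hilbert space direct sum over $k\ge 0$ of the spaces of symmetric functions in $L^2((\mathbb R^n)^k, d^n\mu(\mathbf p_1)\cdots d^n\mu(\mathbf p_k))$, and let $\mathscr D\subset\mathscr F^+$ be the space of finite-particle vectors whose components are symmetric Schwartz functions. On $\mathscr D$ let $$(a(\mathbf p)\Psi)_k(\mathbf p_1,\dots,\mathbf p_k)=\frac{\sqrt{k+1}}{\sqrt{2\omega_{\mathbf p}}}\,\Psi_{k+1}(\mathbf p,\mathbf p_1,\dots,\mathbf p_k),\qquad \tilde a(\mathbf x)=(2\pi)^{-n/2}\int d^n\mathbf p\,e^{-ip_kx^k}a(\mathbf p),$$ the integral being an $\mathscr F^+$-valued one. Let $a^*(\mathbf p)$, $\tilde a^*(\mathbf x)$ be the adjoints as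 sesquilinear forms on $\mathscr D$; an identity between an operator $T:\mathscr D\to\mathscr D$ and an integral of products $a^*a$ means that $\langle\Phi,T\Psi\rangle$ equals the (absolutely convergent, unless said otherwise) integral of the corresponding expression, e.g. of $\langle a(\mathbf p)\Phi,a(\mathbf q)\Psi\rangle$ for $a^*(\mathbf p)a(\mathbf q)$, for all $\Phi,\Psi\in\mathscr D$. Then $\mathbf p\mapsto a(\mathbf p)\Psi$ is integrable and differentiable and $\mathbf x\mapsto\tilde a(\mathbf x)\Psi$ is differentiable in $\mathscr F^+$ for every $\Psi\in\mathscr D$, and for all $i,j,k\in\{1,\dots,n\}$ there are unique linear operators $M_{j0}$ (boosts) and $M_{ik}$ (rotations) from $\mathscr D$ to $\mathscr D$ with $$M_{j0}=i\int d^n\mathbf p\,a^*(\mathbf p)\Big(\frac{p_j}{2\omega_{\mathbf p}}-\omega_{\mathbf p}\frac{\partial}{\partial p^j}\Big)a(\mathbf p),\qquad M_{ik}=i\int d^n\mathbf p\,a^*(\mathbf p)\Big(p_i\frac{\partial}{\partial p^k}-p_k\frac{\partial}{\partial p^i}\Big)a(\mathbf p).$$ For $\mathbf x\ne 0$ let $$\tilde\omega(\mathbf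 x)=-2(2\pi)^{-\frac{n+1}2}\Big(\frac m{|\mathbf x|}\Big)^{\frac{n+1}2}K_{\frac{n+1}2}(m|\mathbf x|),$$ where $K_\nu$ is the modified Bessel function of the second kind. Integrals containing the non-integrable kernel $\tilde\omega$ are understood as Hadamard finite parts: the integral over the region at distance more than $\varepsilon$ from the singularity (it converges absolutely) has the form $C/\varepsilon+L+o(1)$ as $\varepsilon\downarrow0$, and the value is $L$. In this sense $\tilde\omega$ is, as a tempered distribution, the Fourier transform $(2\pi)^{-n}\int d^n\mathbf p\,\omega_{\mathbf p}e^{-ip_kx^k}$ of $\omega_{\mathbf p}$, and in coordinate space $$M_{j0}=\frac12\iint d^n\mathbf x\,d^n\mathbf y\,(x+y)_j\,\tilde\omega(\mathbf x-\mathbf y)\,\tilde a^*(\mathbf x)\tilde a(\mathbf y),\qquad M_{ik}=i\int d^n\mathbf x\,\tilde a^*(\mathbf x)\Big(x_i\frac{\partial}{\partial x^k}-x_k\frac{\partial}{\partial x^i}\Big)\tilde a(\mathbf x).$$ -/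

import Mathlib

open MeasureTheory Filter Topology
open scoped SchwartzMap ENNReal NNReal InnerProductSpace

namespace ScalarField

noncomputable section

/-- Space `ℝⁿ` (of momenta as well as of positions), with the Euclidean norm.
The coordinates `x j` are the contravariant components `x^j`. -/
abbrev E (n : ℕ) : Type := EuclideanSpace ℝ (Fin n)

variable {n : ℕ}

/-- The covariant spatial component `x_j = -x^j`; the metric has signature `(+,-,…,-)`. -/
def covComp (x : E n) (j : Fin n) : ℝ := -x j

/-- The spatial contraction `p_k x^k` (summed over `k = 1, …, n`). -/
def contract (p x : E n) : ℝ := ∑ k, covComp p k * x k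

/-- The energy `ω_p = √(|p|² + m²)`. -/
def omega (m : ℝ) (p : E n) : ℝ := Real.sqrt (‖p‖ ^ 2 + m ^ 2)

/-- The partial derivative `∂F/∂x^j` of a function with values in a normed space. -/
def partialDeriv {V : Type*} [NormedAddCommGroup V] [NormedSpace ℝ V] (j : Fin n)
    (F : E n → V) (x : E n) : V :=
  fderiv ℝ F x (EuclideanSpace.single j 1)

/-! ### The Bosonic Fock space -/

/-- The Lorentz invariant measure `dⁿμ(p) = dⁿp / (2 ω_p)`. -/
def muMeas (n : ℕ) (m : ℝ) : Measure (E n) :=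
  volume.withDensity fun p => ENNReal.ofReal (1 / (2 * omega m p))

/-- The measure `dⁿμ(p₁) ⋯ dⁿμ(p_k)`. -/
def muPi (n : ℕ) (m : ℝ) (k : ℕ) : Measure (Fin k → E n) :=
  Measure.pi fun _ => muMeas n m

instance instSigmaFiniteMuMeas (m : ℝ) : SigmaFinite (muMeas n m) :=
  SigmaFinite.withDensity (μ := (volume : Measure (E n)))
    (fun p => Real.toNNReal (1 / (2 * omega m p)))

lemma measurePreserving_perm (m : ℝ) (k : ℕ) (σ : Equiv.Perm (Fin k)) :
    MeasurePreserving (fun P : Fin k → E n => P ∘ σ) (muPi n m k) (muPi n m k) := by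
  have h := measurePreserving_piCongrLeft (α := fun _ : Fin k => E n)
    (fun _ => muMeas n m) σ.symm
  have e : (fun P : Fin k → E n => P ∘ σ)
      = MeasurableEquiv.piCongrLeft (fun _ : Fin k => E n) σ.symm := by
    ext P i
    simp [MeasurableEquiv.coe_piCongrLeft, Equiv.piCongrLeft_apply]
  rw [e]
  exact h

/-- The `k`-particle space: square integrable functions of `k` momenta, with respect to
`dⁿμ(p₁) ⋯ dⁿμ(p_k)`, which are invariant under permutations of the momenta. -/
def kParticle (n : ℕ) (m : ℝ) (k : ℕ) : Submodule ℂ (Lp ℂ 2 (muPi n m k)) :=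
  ⨅ σ : Equiv.Perm (Fin k), LinearMap.eqLocus
    (Lp.compMeasurePreservingₗᵢ ℂ _ (measurePreserving_perm m k σ)).toLinearMap LinearMap.id

instance instCompleteKParticle (m : ℝ) (k : ℕ) : CompleteSpace (kParticle n m k) := by
  have : IsClosed (kParticle n m k : Set (Lp ℂ 2 (muPi n m k))) := by
    rw [kParticle, Submodule.coe_iInf]
    refine isClosed_iInter fun σ => ?_
    exact isClosed_eq
      (Lp.compMeasurePreservingₗᵢ ℂ _ (measurePreserving_perm m k σ)).continuous continuous_id
  exact this.completeSpace_coe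

/-- The Bosonic Fock space: the Hilbert space direct sum of the `k`-particle spaces. -/
def FockSpace (n : ℕ) (m : ℝ) : Type := lp (fun k : ℕ => kParticle n m k) 2

instance instNACGFock (m : ℝ) : NormedAddCommGroup (FockSpace n m) :=
  inferInstanceAs (NormedAddCommGroup (lp (fun k : ℕ => kParticle n m k) 2))

instance instIPSFock (m : ℝ) : InnerProductSpace ℂ (FockSpace n m) :=
  inferInstanceAs (InnerProductSpace ℂ (lp (fun k : ℕ => kParticle n m k) 2))

instance instCompleteFock (m : ℝ) : CompleteSpace (FockSpace n m) :=
  inferInstanceAs (CompleteSpace (lp (fun k : ℕ => kParticle n m k) 2))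

/-! ### Finite-particle states with Schwartz wave functions -/

/-- The common domain of the operators: finite-particle vectors all of whose components are
symmetric Schwartz functions of the momenta. -/
def SchwartzDomain (n : ℕ) : Submodule ℂ ((k : ℕ) → 𝓢(Fin k → E n, ℂ)) where
  carrier := {Ψ | {k | Ψ k ≠ 0}.Finite ∧
    ∀ (k : ℕ) (σ : Equiv.Perm (Fin k)) (P : Fin k → E n), Ψ k (P ∘ σ) = Ψ k P}
  add_mem' := by
    rintro Ψ Φ ⟨h1, h2⟩ ⟨h3, h4⟩
    refine ⟨(h1.union h3).subset fun k hk => ?_, fun k σ P => by simp [h2, h4]⟩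
    by_contra hc
    simp only [Set.mem_union, Set.mem_ofPred_eq, not_or, not_not] at hc
    exact hk (by simp [hc.1, hc.2])
  zero_mem' := ⟨by simp, by simp⟩
  smul_mem' := by
    rintro c Ψ ⟨h1, h2⟩
    refine ⟨h1.subset fun k hk => ?_, fun k σ P => by simp [h2]⟩
    intro hc
    exact hk (by simp [hc])

lemma muMeas_le {m : ℝ} (hm : 0 < m) :
    muMeas n m ≤ ENNReal.ofReal (1 / (2 * m)) • (volume : Measure (E n)) := by
  rw [← withDensity_const, muMeas]
  refine withDensity_mono (Eventually.of_forall fun p => ENNReal.ofReal_le_ofReal ?_)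
  have : m ≤ omega m p := Real.le_sqrt_of_sq_le (by nlinarith [sq_nonneg ‖p‖])
  gcongr

instance instTemperateMuMeas (m : ℝ) [hm : Fact (0 < m)] : (muMeas n m).HasTemperateGrowth := by
  obtain ⟨N, hN⟩ := (inferInstance : (volume : Measure (E n)).HasTemperateGrowth)
  exact ⟨N, (hN.smul_measure ENNReal.ofReal_ne_top).mono_measure (muMeas_le hm.out)⟩

instance instTemperateMuPi (m : ℝ) [hm : Fact (0 < m)] (k : ℕ) :
    (muPi n m k).HasTemperateGrowth := by
  obtain ⟨N, hN⟩ := instTemperateMuMeas (n := n) m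
  refine ⟨N * k, ?_⟩
  have h : Integrable (fun P : Fin k → E n => ∏ i, (1 + ‖P i‖) ^ (-(N : ℝ))) (muPi n m k) :=
    Integrable.fintype_prod (μ := fun _ : Fin k => muMeas n m)
      (f := fun _ p => (1 + ‖p‖) ^ (-(N : ℝ))) fun _ => hN
  refine h.mono' ?_ (Eventually.of_forall fun P => ?_)
  · refine Continuous.aestronglyMeasurable ?_
    refine Continuous.rpow_const (by fun_prop) fun P => Or.inl (by positivity)
  · rw [Real.norm_of_nonneg (by positivity)]
    have e : (1 + ‖P‖) ^ (-((N * k : ℕ) : ℝ)) = ∏ _i : Fin k, (1 + ‖P‖) ^ (-(N : ℝ)) := by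
      rw [Finset.prod_const, Finset.card_univ, Fintype.card_fin, ← Real.rpow_natCast,
        ← Real.rpow_mul (by positivity)]
      push_cast; ring_nf
    rw [e]
    refine Finset.prod_le_prod (fun _ _ => by positivity) fun i _ => ?_
    exact Real.rpow_le_rpow_of_nonpos (by positivity) (by gcongr; exact norm_le_pi_norm P i)
      (by simp)

lemma toLp_mem_kParticle {m : ℝ} [Fact (0 < m)] (Ψ : SchwartzDomain n) (k : ℕ) :
    (Ψ.1 k).toLp 2 (muPi n m k) ∈ kParticle n m k := by
  rw [kParticle, Submodule.mem_iInf]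
  intro σ
  rw [LinearMap.mem_eqLocus]
  have hσ := measurePreserving_perm (n := n) m k σ
  refine Lp.ext ?_
  have h1 : (Lp.compMeasurePreserving _ hσ ((Ψ.1 k).toLp 2 (muPi n m k)) : _ → ℂ)
      =ᵐ[muPi n m k] _ := Lp.coeFn_compMeasurePreserving _ hσ
  have h2 := (Ψ.1 k).coeFn_toLp 2 (muPi n m k)
  have h3 := hσ.quasiMeasurePreserving.ae_eq_comp h2
  refine (h1.trans h3).trans ?_
  refine EventuallyEq.trans ?_ h2.symm
  exact Eventually.of_forall fun P => Ψ.2.2 k σ P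

/-- The inclusion of the domain of Schwartz states into the Fock space. -/
def toFock (m : ℝ) [Fact (0 < m)] : SchwartzDomain n →ₗ[ℂ] FockSpace n m where
  toFun Ψ := ⟨fun k => ⟨(Ψ.1 k).toLp 2 (muPi n m k), toLp_mem_kParticle Ψ k⟩,
    (memℓp_zero (Ψ.2.1.subset fun k hk => by
      intro hc
      refine hk (Subtype.ext ?_)
      change (Ψ.1 k).toLp 2 (muPi n m k) = 0
      rw [hc]
      exact (SchwartzMap.toLpCLM ℂ ℂ 2 (muPi n m k)).map_zero)).of_exponent_ge (zero_le)⟩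
  map_add' _ _ := rfl
  map_smul' _ _ := rfl

/-! ### Ladder operators -/

lemma cons_hasTemperateGrowth (p : E n) (k : ℕ) :
    Function.HasTemperateGrowth
      (fun q : Fin k → E n => (Fin.cons p q : Fin (k + 1) → E n)) := by
  let L : (Fin k → E n) →L[ℝ] (Fin (k + 1) → E n) :=
    ContinuousLinearMap.pi fun i =>
      Fin.cases (motive := fun _ => (Fin k → E n) →L[ℝ] E n) 0
        (fun i => ContinuousLinearMap.proj i) i
  have h : (fun q : Fin k → E n => (Fin.cons p q : Fin (k + 1) → E n))
      = (fun _ => (Fin.cons p 0 : Fin (k + 1) → E n)) + (fun q => L q) := by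
    ext q i
    refine Fin.cases ?_ (fun i => ?_) i <;> simp [L]
  rw [h]
  exact (Function.HasTemperateGrowth.const _).add L.hasTemperateGrowth

lemma cons_antilipschitz (p : E n) (k : ℕ) :
    AntilipschitzWith 1
      (fun q : Fin k → E n => (Fin.cons p q : Fin (k + 1) → E n)) := by
  refine AntilipschitzWith.of_le_mul_dist fun q q' => ?_
  rw [NNReal.coe_one, one_mul]
  refine (dist_pi_le_iff dist_nonneg).2 fun i => ?_
  simpa using dist_le_pi_dist (Fin.cons p q : Fin (k + 1) → E n) (Fin.cons p q') i.succ

/-- The function `(p₁, …, p_k) ↦ ψ(p, p₁, …, p_k)`. -/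
def slice (p : E n) (k : ℕ) : 𝓢(Fin (k + 1) → E n, ℂ) →L[ℂ] 𝓢(Fin k → E n, ℂ) :=
  SchwartzMap.compCLMOfAntilipschitz ℂ (cons_hasTemperateGrowth p k) (cons_antilipschitz p k)

lemma slice_apply (p : E n) (k : ℕ) (ψ : 𝓢(Fin (k + 1) → E n, ℂ)) (q : Fin k → E n) :
    slice p k ψ q = ψ (Fin.cons p q) := rfl

/-- The covariant annihilation operator with sharp momentum,
`(a_c(p)Ψ)_k(p₁, …, p_k) = √(k+1) Ψ_{k+1}(p, p₁, …, p_k)`. -/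
def annihilationCov (p : E n) : SchwartzDomain n →ₗ[ℂ] SchwartzDomain n where
  toFun Ψ := ⟨fun k => ((Real.sqrt (k + 1) : ℝ) : ℂ) • slice p k (Ψ.1 (k + 1)), by
    refine ⟨(Ψ.2.1.preimage (f := fun k => k + 1)
      (add_left_injective 1).injOn).subset fun k hk hc => hk (by simp [hc]), fun k σ P => ?_⟩
    have h : (Fin.cons p (P ∘ σ) : Fin (k + 1) → E n)
        = (Fin.cons p P : Fin (k + 1) → E n) ∘ Equiv.Perm.decomposeFin.symm (0, σ) := by
      ext i
      refine Fin.cases ?_ (fun i => ?_) i <;> simp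
    simp [slice_apply, h, Ψ.2.2]⟩
  map_add' Ψ Φ := by
    refine Subtype.ext (funext fun k => ?_)
    simp
  map_smul' c Ψ := by
    refine Subtype.ext (funext fun k => ?_)
    simp [smul_comm c]

/-- The (noncovariant) annihilation operator `a(p) = a_c(p) / √(2 ω_p)`, applied to a Schwartz
state and regarded as a vector of the Fock space. The creation operator `a*(p)` is its adjoint as
a sesquilinear form: `⟨Φ, a*(p) Ψ⟩ = ⟨a(p) Φ, Ψ⟩`. -/
def ann (m : ℝ) [Fact (0 < m)] (p : E n) (Ψ : SchwartzDomain n) : FockSpace n m :=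
  (((Real.sqrt (2 * omega m p))⁻¹ : ℝ) : ℂ) • toFock m (annihilationCov p Ψ)

/-- The coordinate space annihilation operator
`ã(x) = (2π)^{-n/2} ∫ dⁿp e^{-i p_k x^k} a(p)`. The operator `ã*(x)` is its adjoint as a
sesquilinear form. -/
def annTilde (m : ℝ) [Fact (0 < m)] (x : E n) (Ψ : SchwartzDomain n) : FockSpace n m :=
  (((2 * Real.pi) ^ (-(n : ℝ) / 2) : ℝ) : ℂ) •
    ∫ p : E n, Complex.exp (-Complex.I * (contract p x : ℝ)) • ann m p Ψ

/-! ### The Lorentz generators in momentum space -/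

/-- The operator `T` on Schwartz states is the boost generator
`M_{j0} = i ∫ dⁿp a*(p) (p_j / (2 ω_p) - ω_p ∂/∂p^j) a(p)`. -/
def IsBoostGenerator (m : ℝ) [Fact (0 < m)] (j : Fin n)
    (T : SchwartzDomain n →ₗ[ℂ] SchwartzDomain n) : Prop :=
  ∀ Φ Ψ : SchwartzDomain n,
    Integrable (fun p : E n => ⟪ann m p Φ,
      ((covComp p j / (2 * omega m p) : ℝ) : ℂ) • ann m p Ψ
        - ((omega m p : ℝ) : ℂ) • partialDeriv j (fun q => ann m q Ψ) p⟫_ℂ) ∧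
    ⟪toFock m Φ, toFock m (T Ψ)⟫_ℂ = Complex.I * ∫ p : E n, ⟪ann m p Φ,
      ((covComp p j / (2 * omega m p) : ℝ) : ℂ) • ann m p Ψ
        - ((omega m p : ℝ) : ℂ) • partialDeriv j (fun q => ann m q Ψ) p⟫_ℂ

/-- The operator `T` on Schwartz states is the rotation generator
`M_{ik} = i ∫ dⁿp a*(p) (p_i ∂/∂p^k - p_k ∂/∂p^i) a(p)`. -/
def IsRotationGenerator (m : ℝ) [Fact (0 < m)] (i k : Fin n)
    (T : SchwartzDomain n →ₗ[ℂ] SchwartzDomain n) : Prop :=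
  ∀ Φ Ψ : SchwartzDomain n,
    Integrable (fun p : E n => ⟪ann m p Φ,
      ((covComp p i : ℝ) : ℂ) • partialDeriv k (fun q => ann m q Ψ) p
        - ((covComp p k : ℝ) : ℂ) • partialDeriv i (fun q => ann m q Ψ) p⟫_ℂ) ∧
    ⟪toFock m Φ, toFock m (T Ψ)⟫_ℂ = Complex.I * ∫ p : E n, ⟪ann m p Φ,
      ((covComp p i : ℝ) : ℂ) • partialDeriv k (fun q => ann m q Ψ) p
        - ((covComp p k : ℝ) : ℂ) • partialDeriv i (fun q => ann m q Ψ) p⟫_ℂ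

/-! ### The kernel `ω̃` -/

/-- The modified Bessel function of the second kind, `K_ν(r) = ∫₀^∞ e^{-r cosh t} cosh(ν t) dt`
for `r > 0`. -/
def besselK (ν r : ℝ) : ℝ :=
  ∫ t in Set.Ioi (0 : ℝ), Real.exp (-r * Real.cosh t) * Real.cosh (ν * t)

/-- `ω̃(x) = -2 (2π)^{-(n+1)/2} (m/|x|)^{(n+1)/2} K_{(n+1)/2}(m|x|)`, for `x ≠ 0`. -/
def omegaTilde (m : ℝ) (x : E n) : ℝ :=
  -2 * (2 * Real.pi) ^ (-((n : ℝ) + 1) / 2) * (m / ‖x‖) ^ (((n : ℝ) + 1) / 2) *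
    besselK (((n : ℝ) + 1) / 2) (m * ‖x‖)

/-- `L` is the Hadamard finite part of the divergent integral whose truncation at distance `ε`
from the singularity is `J ε`: `J ε = C / ε + L + o(1)` as `ε ↓ 0`, for some constant `C`.
Such an `L` is unique. -/
def HasFinitePart (J : ℝ → ℂ) (L : ℂ) : Prop :=
  ∃ C : ℂ, Tendsto (fun ε : ℝ => J ε - C / (ε : ℂ)) (𝓝[>] 0) (𝓝 L)

end

end ScalarField

open ScalarField

namespace ScalarField

open scoped LineDeriv ContDiff FourierTransform

variable {n : ℕ}

/-! ### Integral representations of the square root and of the Bessel kernel -/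

/-! Kernel. For `a > 0`, `2√π √a = ∫₀^∞ (1 - e^{-at}) t^{-3/2} dt`. Take `a = |p|² + m²`: since
`e^{-t|p|²}` is the Fourier transform of the heat kernel and `1` is its total mass, exchanging
integrals gives `ω_p = ∫ (S₀(x) - S_m(x) cos(p·x)) dx` (`integral_subordKernel_sub`), where `S_m` is
`subordKernel m`. The substitution `t = (|x|/2m) e^s` turns `S_m` into a Bessel function, and `S_m =
-ω̃` (`omegaTilde_eq`). The massless `S₀` is homogeneous of degree `-(n+1)`, so its integral over
`|x| > ε` is exactly `C/ε`, the pole of the Hadamard finite part. As `0 ≤ S_m ≤ S₀`, the integrand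
is nonnegative, every truncation is bounded by `ω_p`, and dominated convergence gives the finite
part of `∫ ω̃ φ` for `φ` a Fourier integral (`finitePart_omegaTilde`). Momentum space. `p ↦ a(p)Ψ`
is a Fock space valued Schwartz map, obtained from the slices of the wave functions. The derivative
of the factor `(2ω)^{-1/2}` in `a(p)` cancels the term `p_j/(2ω)` of the boost, and drops out of the
rotation by antisymmetry. What remains are first-order vector fields acting on each particle
(`dGamma`), whose matrix elements are computed by `inner_toFock_dGamma`. Uniqueness holds because
the Schwartz states embed injectively in the Fock space. Coordinate space. Plancherel with a
translation, `∫ ⟪f̃(x), g̃(x+u)⟫ dx = ∫ e^{ip·u} ⟪f, g⟫ dp`, combined with the finite part result,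
identifies the form with kernel `ω̃(x-y)` with multiplication by `ω`
(`finitePart_omegaTilde_pairing`). In the boost, `x_j` and `y_j` become derivatives of the two
momentum space factors; integrating one of them by parts differentiates `ω` and produces `p_j/(2ω)`.
Rotations commute with the Fourier transform. -/

lemma integrableOn_rpow_mul_one_sub_exp {a : ℝ} (ha : 0 ≤ a) :
    IntegrableOn (fun t : ℝ => (1 - Real.exp (-(a * t))) * t ^ (-(3 / 2) : ℝ)) (Set.Ioi 0) := by
  have hm : Measurable (fun t : ℝ => (1 - Real.exp (-(a * t))) * t ^ (-(3 / 2) : ℝ)) := by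
    fun_prop
  rw [← Set.Ioc_union_Ioi_eq_Ioi (zero_le_one (α := ℝ))]
  refine IntegrableOn.union ?_ ?_
  · have h : IntegrableOn (fun t : ℝ => a * t ^ (-(1 / 2) : ℝ)) (Set.Ioc 0 1) :=
      (((intervalIntegrable_iff_integrableOn_Ioc_of_le zero_le_one).1
        (intervalIntegral.intervalIntegrable_rpow' (by norm_num))).const_mul a)
    refine Integrable.mono' h hm.aestronglyMeasurable ?_
    filter_upwards [ae_restrict_mem measurableSet_Ioc] with t ht
    have ht0 : 0 < t := ht.1
    have h1 : 0 ≤ 1 - Real.exp (-(a * t)) := by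
      have : Real.exp (-(a * t)) ≤ 1 := Real.exp_le_one_iff.2 (by nlinarith)
      linarith
    have h2 : 1 - Real.exp (-(a * t)) ≤ a * t := by
      have := Real.add_one_le_exp (-(a * t)); linarith
    rw [Real.norm_of_nonneg (by positivity)]
    calc _ ≤ (a * t) * t ^ (-(3 / 2) : ℝ) := by gcongr
      _ = a * t ^ (-(1 / 2) : ℝ) := by
        rw [mul_assoc]; congr 1
        nth_rewrite 1 [← Real.rpow_one t]
        rw [← Real.rpow_add ht0]; norm_num
  · have h : IntegrableOn (fun t : ℝ => t ^ (-(3 / 2) : ℝ)) (Set.Ioi 1) :=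
      integrableOn_Ioi_rpow_of_lt (by norm_num) one_pos
    refine Integrable.mono' h hm.aestronglyMeasurable ?_
    filter_upwards [ae_restrict_mem measurableSet_Ioi] with t ht
    have ht0 : (0 : ℝ) < t := one_pos.trans ht
    have h1 : Real.exp (-(a * t)) ≤ 1 := Real.exp_le_one_iff.2 (by nlinarith)
    have h3 := Real.exp_pos (-(a * t))
    rw [norm_mul, Real.norm_of_nonneg (by linarith), Real.norm_of_nonneg (by positivity)]
    exact mul_le_of_le_one_left (by positivity) (by linarith)

/-- Integration by parts with the antiderivative `-2 t^{-1/2}`: both boundary terms vanish and the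
remaining integral is `2a Γ(1/2) a^{-1/2}`. -/
lemma integral_rpow_mul_one_sub_exp {a : ℝ} (ha : 0 < a) :
    ∫ t in Set.Ioi (0 : ℝ), (1 - Real.exp (-(a * t))) * t ^ (-(3 / 2) : ℝ)
      = 2 * Real.sqrt Real.pi * Real.sqrt a := by
  have hint := integrableOn_rpow_mul_one_sub_exp ha.le
  have hu : ∀ t ∈ Set.Ioi (0 : ℝ),
      HasDerivAt (fun t => 1 - Real.exp (-(a * t))) (a * Real.exp (-(a * t))) t := by
    intro t _
    have h := ((((hasDerivAt_id t).const_mul a).neg).exp).const_sub 1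
    convert! h using 1
    simp; ring
  have hv : ∀ t ∈ Set.Ioi (0 : ℝ),
      HasDerivAt (fun t : ℝ => -2 * t ^ (-(1 / 2) : ℝ)) (t ^ (-(3 / 2) : ℝ)) t := by
    intro t ht
    have h := (Real.hasDerivAt_rpow_const (x := t) (p := -(1 / 2)) (Or.inl ht.ne')).const_mul (-2)
    convert! h using 1
    rw [show (-(1 / 2) - 1 : ℝ) = -(3 / 2) by norm_num]; ring
  have hg0 : IntegrableOn (fun t : ℝ => t ^ ((1 / 2 : ℝ) - 1) * Real.exp (-(a * t)))
      (Set.Ioi 0) := by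
    -- A non-integrable function has integral `0` by convention, so the nonzero Gamma value already
    -- gives integrability.
    refine Integrable.of_integral_ne_zero ?_
    rw [Real.integral_rpow_mul_exp_neg_mul_Ioi (by norm_num) ha]
    have := Real.Gamma_pos_of_pos (s := 1 / 2) (by norm_num)
    positivity
  have hg : IntegrableOn ((fun t => a * Real.exp (-(a * t))) *
      (fun t : ℝ => -2 * t ^ (-(1 / 2) : ℝ))) (Set.Ioi 0) := by
    refine (Integrable.const_mul hg0 (-2 * a)).congr (Eventually.of_forall fun t => ?_)
    simp only [Pi.mul_apply]
    rw [show ((1 / 2 : ℝ) - 1) = -(1 / 2) by norm_num]; ring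
  have hz : Tendsto ((fun t => 1 - Real.exp (-(a * t))) * (fun t : ℝ => -2 * t ^ (-(1 / 2) : ℝ)))
      (𝓝[>] 0) (𝓝 0) := by
    refine squeeze_zero_norm' (a := fun t => 2 * a * t ^ (1 / 2 : ℝ)) ?_ ?_
    · filter_upwards [self_mem_nhdsWithin] with t (ht : 0 < t)
      have h1 : 0 ≤ 1 - Real.exp (-(a * t)) := by
        have : Real.exp (-(a * t)) ≤ 1 := Real.exp_le_one_iff.2 (by nlinarith)
        linarith
      have h2 : 1 - Real.exp (-(a * t)) ≤ a * t := by
        have := Real.add_one_le_exp (-(a * t)); linarith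
      simp only [Pi.mul_apply, norm_mul, norm_neg, Real.norm_ofNat]
      rw [Real.norm_of_nonneg h1, Real.norm_of_nonneg (by positivity)]
      calc _ ≤ (a * t) * (2 * t ^ (-(1 / 2) : ℝ)) := by gcongr
        _ = 2 * a * (t * t ^ (-(1 / 2) : ℝ)) := by ring
        _ = _ := by
          congr 1
          nth_rewrite 1 [← Real.rpow_one t]
          rw [← Real.rpow_add ht]; norm_num
    · have : ContinuousAt (fun t : ℝ => 2 * a * t ^ (1 / 2 : ℝ)) 0 :=
        (continuousAt_const.mul (Real.continuousAt_rpow_const _ _ (Or.inr (by norm_num))))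
      have h := this.tendsto.mono_left (nhdsWithin_le_nhds (s := Set.Ioi 0))
      simpa using h
  have hi : Tendsto ((fun t => 1 - Real.exp (-(a * t))) * (fun t : ℝ => -2 * t ^ (-(1 / 2) : ℝ)))
      atTop (𝓝 0) := by
    have h1 : Tendsto (fun t : ℝ => 1 - Real.exp (-(a * t))) atTop (𝓝 (1 - 0)) :=
      tendsto_const_nhds.sub (Real.tendsto_exp_neg_atTop_nhds_zero.comp
        (tendsto_id.const_mul_atTop ha))
    have h2 : Tendsto (fun t : ℝ => -2 * t ^ (-(1 / 2) : ℝ)) atTop (𝓝 (-2 * 0)) :=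
      (tendsto_rpow_neg_atTop (by norm_num)).const_mul _
    have h := h1.mul h2
    rw [mul_zero, mul_zero] at h
    exact h
  rw [integral_Ioi_mul_deriv_eq_deriv_mul hu hv hint hg hz hi]
  have e : ∀ t : ℝ, a * Real.exp (-(a * t)) * (-2 * t ^ (-(1 / 2) : ℝ))
      = (-2 * a) * (t ^ ((1 / 2 : ℝ) - 1) * Real.exp (-(a * t))) := by
    intro t
    rw [show ((1 / 2 : ℝ) - 1) = -(1 / 2) by norm_num]; ring
  simp_rw [e]
  rw [integral_const_mul, Real.integral_rpow_mul_exp_neg_mul_Ioi (by norm_num) ha,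
    Real.Gamma_one_half_eq, ← Real.sqrt_eq_rpow, Real.sqrt_div zero_le_one, Real.sqrt_one]
  have : Real.sqrt a ≠ 0 := (Real.sqrt_pos.2 ha).ne'
  field_simp
  rw [Real.sq_sqrt ha.le]
  ring

/-- The heat kernel `(4πt)^{-n/2} e^{-|x|²/(4t)}`, weighted by `t^{-3/2} / (2√π)`. -/
noncomputable def heatWeight (t : ℝ) (x : E n) : ℝ :=
  (2 * Real.sqrt Real.pi)⁻¹ * t ^ (-(3 / 2) : ℝ) *
    ((4 * Real.pi * t) ^ (-(n : ℝ) / 2) * Real.exp (-(4 * t)⁻¹ * ‖x‖ ^ 2))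

/-- The subordinated heat kernel `∫₀^∞ e^{-tm²} heatWeight t x dt`, the kernel of
`-√(m² - Δ)` off the diagonal. -/
noncomputable def subordKernel (m : ℝ) (x : E n) : ℝ :=
  ∫ t in Set.Ioi (0 : ℝ), heatWeight t x * Real.exp (-(m ^ 2 * t))

lemma heatWeight_nonneg {t : ℝ} (ht : 0 ≤ t) (x : E n) : 0 ≤ heatWeight t x := by
  unfold heatWeight; positivity

lemma measurable_heatWeight : Measurable fun z : E n × ℝ => heatWeight z.2 z.1 := by
  unfold heatWeight; fun_prop

/-- The powers of `t` collect to `-ν - 1` with `ν = (n+1)/2`, the Bessel index; both later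
substitutions start from this form. -/
lemma heatWeight_eq {t : ℝ} (ht : 0 < t) (x : E n) :
    heatWeight t x = (2 * Real.sqrt Real.pi)⁻¹ * (4 * Real.pi) ^ (-(n : ℝ) / 2) *
      (t ^ (-(((n : ℝ) + 1) / 2) - 1) * Real.exp (-(‖x‖ ^ 2 / 4 * t⁻¹))) := by
  unfold heatWeight
  rw [Real.mul_rpow (by positivity) ht.le,
    show (-(((n : ℝ) + 1) / 2) - 1) = -(3 / 2) + (-(n : ℝ) / 2) by ring, Real.rpow_add ht]
  rw [show -(4 * t)⁻¹ * ‖x‖ ^ 2 = -(‖x‖ ^ 2 / 4 * t⁻¹) by rw [mul_inv]; ring]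
  ring

/-- The inversion `t ↦ 1/t` makes this a Gamma integral. Away from the origin the Gaussian factor
suppresses the singularity at `t = 0`. -/
lemma heatWeight_integrableOn {x : E n} (hx : x ≠ 0) :
    IntegrableOn (fun t => heatWeight t x) (Set.Ioi 0) ∧
    ∫ t in Set.Ioi (0 : ℝ), heatWeight t x = (2 * Real.sqrt Real.pi)⁻¹ *
      (4 * Real.pi) ^ (-(n : ℝ) / 2) * ((1 / (‖x‖ ^ 2 / 4)) ^ (((n : ℝ) + 1) / 2) *
        Real.Gamma (((n : ℝ) + 1) / 2)) := by
  set ν : ℝ := ((n : ℝ) + 1) / 2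
  have hν : 0 < ν := by positivity
  set b : ℝ := ‖x‖ ^ 2 / 4
  have hb : 0 < b := by have := norm_pos_iff.2 hx; positivity
  set g : ℝ → ℝ := fun s => s ^ (ν - 1) * Real.exp (-(b * s))
  have hg : ∫ s in Set.Ioi 0, g s = (1 / b) ^ ν * Real.Gamma ν :=
    Real.integral_rpow_mul_exp_neg_mul_Ioi hν hb
  have hgi : IntegrableOn g (Set.Ioi 0) := by
    refine Integrable.of_integral_ne_zero ?_
    rw [hg]
    have := Real.Gamma_pos_of_pos hν
    positivity
  have e : Set.EqOn (fun t : ℝ => (|(-1 : ℝ)| * t ^ ((-1 : ℝ) - 1)) • g (t ^ (-1 : ℝ)))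
      (fun t => t ^ (-ν - 1) * Real.exp (-(b * t⁻¹))) (Set.Ioi 0) := by
    intro t ht
    have ht : 0 < t := ht
    simp only [g, smul_eq_mul, abs_neg, abs_one, one_mul]
    rw [← mul_assoc, ← Real.rpow_mul ht.le, ← Real.rpow_add ht, Real.rpow_neg_one]
    congr 2
    ring
  have e2 : Set.EqOn (fun t => heatWeight t x) (fun t => (2 * Real.sqrt Real.pi)⁻¹ *
      (4 * Real.pi) ^ (-(n : ℝ) / 2) * (t ^ (-ν - 1) * Real.exp (-(b * t⁻¹)))) (Set.Ioi 0) :=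
    fun t ht => heatWeight_eq ht x
  constructor
  · rw [integrableOn_congr_fun e2 measurableSet_Ioi]
    refine Integrable.const_mul ?_ _
    have := (integrableOn_Ioi_comp_rpow_iff g (p := -1) (by norm_num)).2 hgi
    rwa [integrableOn_congr_fun e measurableSet_Ioi] at this
  · rw [setIntegral_congr_fun measurableSet_Ioi e2, integral_const_mul, ← hg,
      ← integral_comp_rpow_Ioi g (p := -1) (by norm_num), setIntegral_congr_fun measurableSet_Ioi e]

lemma heatWeight_mul_exp_integrableOn (m : ℝ) {x : E n} (hx : x ≠ 0) :
    IntegrableOn (fun t => heatWeight t x * Real.exp (-(m ^ 2 * t))) (Set.Ioi 0) := by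
  refine Integrable.mono (heatWeight_integrableOn hx).1 ?_ ?_
  · exact (((measurable_heatWeight (n := n)).comp (measurable_const.prodMk measurable_id)).mul
      (by fun_prop)).aestronglyMeasurable
  · filter_upwards [ae_restrict_mem measurableSet_Ioi] with t ht
    rw [norm_mul]
    refine mul_le_of_le_one_right (norm_nonneg _) ?_
    rw [Real.norm_of_nonneg (Real.exp_pos _).le, Real.exp_le_one_iff]
    have : (0 : ℝ) < t := ht
    nlinarith [sq_nonneg m, mul_nonneg (sq_nonneg m) this.le]

lemma subordKernel_nonneg (m : ℝ) (x : E n) : 0 ≤ subordKernel m x :=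
  setIntegral_nonneg measurableSet_Ioi fun _ ht =>
    mul_nonneg (heatWeight_nonneg (le_of_lt ht) x) (Real.exp_pos _).le

lemma subordKernel_le (m : ℝ) {x : E n} (hx : x ≠ 0) : subordKernel m x ≤ subordKernel 0 x := by
  refine setIntegral_mono_on (heatWeight_mul_exp_integrableOn m hx)
    (heatWeight_mul_exp_integrableOn 0 hx) measurableSet_Ioi fun t ht => ?_
  have ht : (0 : ℝ) < t := ht
  refine mul_le_mul_of_nonneg_left (Real.exp_le_exp.2 ?_) (heatWeight_nonneg ht.le x)
  nlinarith [mul_nonneg (sq_nonneg m) ht.le]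

lemma subordKernel_neg (m : ℝ) (x : E n) : subordKernel m (-x) = subordKernel m x := by
  simp [subordKernel, heatWeight]

lemma measurable_subordKernel (m : ℝ) : Measurable (subordKernel m : E n → ℝ) := by
  have h : StronglyMeasurable fun z : E n × ℝ =>
      heatWeight z.2 z.1 * Real.exp (-(m ^ 2 * z.2)) :=
    (measurable_heatWeight.mul (by fun_prop)).stronglyMeasurable
  exact h.integral_prod_right'.measurable

/-- Homogeneity of degree `-(n+1)` is what makes the divergence of the truncated integrals a pure
`1/ε`; the value of `c` is never needed. -/
lemma exists_subordKernel_zero (n : ℕ) : ∃ c : ℝ, 0 ≤ c ∧ ∀ x : E n, x ≠ 0 →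
    subordKernel 0 x = c * ‖x‖ ^ (-((n : ℝ) + 1)) := by
  refine ⟨(2 * Real.sqrt Real.pi)⁻¹ * (4 * Real.pi) ^ (-(n : ℝ) / 2) * ((4 : ℝ) ^ (((n : ℝ) + 1) / 2)
    * Real.Gamma (((n : ℝ) + 1) / 2)), ?_, fun x hx => ?_⟩
  · have := Real.Gamma_pos_of_pos (s := ((n : ℝ) + 1) / 2) (by positivity)
    positivity
  · have h0 : 0 < ‖x‖ := norm_pos_iff.2 hx
    have : subordKernel 0 x = ∫ t in Set.Ioi (0 : ℝ), heatWeight t x := by simp [subordKernel]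
    rw [this, (heatWeight_integrableOn hx).2, one_div_div, Real.div_rpow (by norm_num) (by positivity),
      ← Real.rpow_natCast, ← Real.rpow_mul h0.le, Real.rpow_neg h0.le]
    rw [show ((2 : ℕ) : ℝ) * (((n : ℝ) + 1) / 2) = n + 1 by push_cast; ring]
    ring

/-- Substituting `t = c e^s` in the subordination integral symmetrizes the exponent `|x|²/(4t) +
m²t` into `m|x| cosh s`. -/
lemma omegaTilde_eq {m : ℝ} (hm : 0 < m) {x : E n} (hx : x ≠ 0) :
    omegaTilde m x = -subordKernel m x := by
  have h0 : 0 < ‖x‖ := norm_pos_iff.2 hx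
  set ν : ℝ := ((n : ℝ) + 1) / 2 with hν
  -- The point where `|x|²/(4t)` and `m²t` balance.
  set c : ℝ := ‖x‖ / (2 * m) with hc
  have hcpos : 0 < c := by positivity
  set G : ℝ → ℝ := fun t => heatWeight t x * Real.exp (-(m ^ 2 * t)) with hG
  set F : ℝ → ℝ := fun s => Real.exp (-(m * ‖x‖) * Real.cosh s) * Real.exp (-ν * s) with hF
  set K : ℝ := (2 * Real.sqrt Real.pi)⁻¹ * (4 * Real.pi) ^ (-(n : ℝ) / 2) * c ^ (-ν) with hK
  have himg : (fun s => c * Real.exp s) '' Set.univ = Set.Ioi 0 := by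
    ext t
    simp only [Set.image_univ, Set.mem_range, Set.mem_Ioi]
    constructor
    · rintro ⟨s, rfl⟩; positivity
    · intro ht
      exact ⟨Real.log (t / c), by rw [Real.exp_log (by positivity)]; field_simp⟩
  have hder : ∀ s ∈ Set.univ, HasDerivWithinAt (fun s => c * Real.exp s) (c * Real.exp s)
      Set.univ s := fun s _ => ((Real.hasDerivAt_exp s).const_mul c).hasDerivWithinAt
  have hinj : Set.InjOn (fun s => c * Real.exp s) Set.univ := fun s _ s' _ h =>
    Real.exp_injective (mul_left_cancel₀ hcpos.ne' h)
  have hpt : (fun s => |c * Real.exp s| • G (c * Real.exp s)) = fun s => K * F s := by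
    funext s
    have hs : 0 < c * Real.exp s := by positivity
    simp only [hG, smul_eq_mul]
    rw [heatWeight_eq hs, abs_of_pos hs, hK, hF, ← hν]
    have e1 : (c * Real.exp s) * (c * Real.exp s) ^ (-ν - 1) = c ^ (-ν) * Real.exp (-ν * s) := by
      nth_rewrite 1 [← Real.rpow_one (c * Real.exp s)]
      rw [← Real.rpow_add hs, show 1 + (-ν - 1) = -ν by ring,
        Real.mul_rpow hcpos.le (Real.exp_pos s).le, ← Real.exp_mul]
      ring_nf
    have e2 : Real.exp (-(‖x‖ ^ 2 / 4 * (c * Real.exp s)⁻¹)) * Real.exp (-(m ^ 2 * (c * Real.exp s)))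
        = Real.exp (-(m * ‖x‖) * Real.cosh s) := by
      rw [← Real.exp_add, Real.cosh_eq, mul_inv, ← Real.exp_neg, hc]
      congr 1
      field_simp
      ring
    beta_reduce
    rw [← e2]
    -- Pure rearrangement: the Jacobian `e` is brought next to the power of `t`, called `f`, so that
    -- `e1` applies.
    rw [show ∀ A B C D e f : ℝ, e * f = C * D → ∀ g h, e * (A * B * (f * g) * h) =
        A * B * C * (g * h * D) by
      intro A B C D e f h1 g h
      rw [show e * (A * B * (f * g) * h) = A * B * (e * f) * g * h by ring, h1]; ring]
    exact e1
  have hFi : Integrable F := by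
    have h := (integrableOn_image_iff_integrableOn_abs_deriv_smul MeasurableSet.univ hder hinj G).1
      (by rw [himg]; exact heatWeight_mul_exp_integrableOn m hx)
    rw [hpt, integrableOn_univ] at h
    exact (integrable_const_mul_iff (IsUnit.mk0 K (by positivity)) F).1 h
  have hint : subordKernel m x = K * ∫ s, F s := by
    have h := integral_image_eq_integral_abs_deriv_smul MeasurableSet.univ hder hinj G
    rw [himg, hpt, setIntegral_univ, integral_const_mul] at h
    exact h
  -- Folding the line at `0`: `cosh s` is even, and `e^{-νs} + e^{νs} = 2 cosh(νs)`.
  have hFK : ∫ s, F s = 2 * besselK ν (m * ‖x‖) := by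
    rw [← intervalIntegral.integral_Iic_add_Ioi (b := 0) hFi.integrableOn hFi.integrableOn,
      ← neg_zero, ← integral_comp_neg_Ioi, neg_zero, ← integral_add
        (by simpa using! (hFi.comp_neg).integrableOn) hFi.integrableOn, besselK, ← integral_const_mul]
    refine integral_congr_ae (Eventually.of_forall fun s => ?_)
    simp only [hF, Real.cosh_neg, Real.cosh_eq (ν * s)]
    ring_nf
  rw [hint, hFK, omegaTilde, ← hν, hK, hc]
  have e1 : (‖x‖ / (2 * m)) ^ (-ν) = 2 ^ ν * (m / ‖x‖) ^ ν := by
    rw [Real.rpow_neg (by positivity), ← Real.inv_rpow (by positivity), ← Real.mul_rpow (by positivity)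
      (by positivity)]
    congr 1
    field_simp
  have hp : 0 < Real.pi := Real.pi_pos
  have e2 : (2 * Real.pi) ^ (-((n : ℝ) + 1) / 2)
      = (2 * Real.sqrt Real.pi)⁻¹ * (4 * Real.pi) ^ (-(n : ℝ) / 2) * 2 ^ ν := by
    rw [Real.sqrt_eq_rpow, mul_inv, ← Real.rpow_neg hp.le, show (4 : ℝ) = 2 ^ (2 : ℝ) by norm_num,
      Real.mul_rpow (by positivity) hp.le, Real.mul_rpow (by positivity) hp.le,
      ← Real.rpow_mul (by norm_num), ← Real.rpow_neg_one 2,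
      show -((n : ℝ) + 1) / 2 = -(1 / 2) + -(n : ℝ) / 2 by ring, Real.rpow_add hp,
      show -(1 / 2) + -(n : ℝ) / 2 = -1 + (2 * (-(n : ℝ) / 2)) + ν by rw [hν]; ring,
      Real.rpow_add (by norm_num), Real.rpow_add (by norm_num)]
    ring
  rw [e1, e2]
  ring

/-! ### The energy as a regularized Fourier integral of the kernel -/

lemma omega_pos {m : ℝ} (hm : 0 < m) (p : E n) : 0 < omega m p :=
  Real.sqrt_pos.2 (by positivity)

lemma omega_sq (m : ℝ) (p : E n) : omega m p ^ 2 = ‖p‖ ^ 2 + m ^ 2 :=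
  Real.sq_sqrt (by positivity)

lemma continuous_omega (m : ℝ) : Continuous (omega m : E n → ℝ) := by
  unfold omega; fun_prop

lemma integrable_gaussian_mul_cos {t : ℝ} (ht : 0 < t) (p : E n) :
    Integrable (fun x : E n => Real.exp (-(4 * t)⁻¹ * ‖x‖ ^ 2) * Real.cos ⟪p, x⟫_ℝ) ∧
    ∫ x : E n, Real.exp (-(4 * t)⁻¹ * ‖x‖ ^ 2) * Real.cos ⟪p, x⟫_ℝ
      = (4 * Real.pi * t) ^ ((n : ℝ) / 2) * Real.exp (-(‖p‖ ^ 2 * t)) := by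
  have hb : 0 < (((4 * t)⁻¹ : ℝ) : ℂ).re := by rw [Complex.ofReal_re]; positivity
  have h1 := GaussianFourier.integrable_cexp_neg_mul_sq_norm_add hb Complex.I p
  have h2 := GaussianFourier.integral_cexp_neg_mul_sq_norm_add hb Complex.I p
  have e : ∀ x : E n, (Complex.exp (-(((4 * t)⁻¹ : ℝ) : ℂ) * (‖x‖ : ℂ) ^ 2
      + Complex.I * ((⟪p, x⟫_ℝ : ℝ) : ℂ))).re
      = Real.exp (-(4 * t)⁻¹ * ‖x‖ ^ 2) * Real.cos ⟪p, x⟫_ℝ := by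
    intro x
    have : (-(((4 * t)⁻¹ : ℝ) : ℂ) * (‖x‖ : ℂ) ^ 2 + Complex.I * ((⟪p, x⟫_ℝ : ℝ) : ℂ))
        = ((-(4 * t)⁻¹ * ‖x‖ ^ 2 : ℝ) : ℂ) + ((⟪p, x⟫_ℝ : ℝ) : ℂ) * Complex.I := by
      push_cast; ring
    rw [this, Complex.exp_add, ← Complex.ofReal_exp, Complex.re_ofReal_mul,
      Complex.exp_ofReal_mul_I_re]
  constructor
  · exact h1.re.congr (Eventually.of_forall e)
  · have h3 := integral_re h1
    rw [h2] at h3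
    rw [← integral_congr_ae (Eventually.of_forall e)]
    refine h3.trans ?_
    have e2 : ((Real.pi : ℂ) / (((4 * t)⁻¹ : ℝ) : ℂ)) ^ ((Module.finrank ℝ (E n) : ℂ) / 2)
        * Complex.exp (Complex.I ^ 2 * (‖p‖ : ℂ) ^ 2 / (4 * (((4 * t)⁻¹ : ℝ) : ℂ)))
        = (((4 * Real.pi * t) ^ ((n : ℝ) / 2) * Real.exp (-(‖p‖ ^ 2 * t)) : ℝ) : ℂ) := by
      rw [Complex.ofReal_mul, Complex.ofReal_cpow (by positivity), Complex.ofReal_exp]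
      have ht' : (t : ℂ) ≠ 0 := by exact_mod_cast ht.ne'
      congr 1
      · congr 1
        · push_cast; field_simp
        · simp
      · congr 1
        push_cast
        rw [Complex.I_sq]
        field_simp
    rw [e2]
    exact Complex.ofReal_re _

/-- At fixed `t` the Gaussian normalization cancels: the term `1` gives the mass of the heat kernel,
and the cosine term gives `e^{-t(|p|²+m²)}`. -/
lemma integral_heatWeight_mul {m t : ℝ} (ht : 0 < t) (p : E n) :
    Integrable (fun x : E n =>
      heatWeight t x * (1 - Real.exp (-(m ^ 2 * t)) * Real.cos ⟪p, x⟫_ℝ)) ∧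
    ∫ x : E n, heatWeight t x * (1 - Real.exp (-(m ^ 2 * t)) * Real.cos ⟪p, x⟫_ℝ)
      = (2 * Real.sqrt Real.pi)⁻¹ *
        ((1 - Real.exp (-(omega m p ^ 2 * t))) * t ^ (-(3 / 2) : ℝ)) := by
  obtain ⟨h1, h2⟩ := integrable_gaussian_mul_cos ht (0 : E n)
  obtain ⟨h3, h4⟩ := integrable_gaussian_mul_cos ht p
  set c := (2 * Real.sqrt Real.pi)⁻¹ * t ^ (-(3 / 2) : ℝ) * (4 * Real.pi * t) ^ (-(n : ℝ) / 2)
  -- The term `1` is the cosine at frequency `0`, so one Gaussian formula serves both terms.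
  have e : (fun x : E n => heatWeight t x * (1 - Real.exp (-(m ^ 2 * t)) * Real.cos ⟪p, x⟫_ℝ))
      = fun x => c * (Real.exp (-(4 * t)⁻¹ * ‖x‖ ^ 2) * Real.cos ⟪(0 : E n), x⟫_ℝ)
        - c * Real.exp (-(m ^ 2 * t)) *
          (Real.exp (-(4 * t)⁻¹ * ‖x‖ ^ 2) * Real.cos ⟪p, x⟫_ℝ) := by
    funext x
    simp only [heatWeight, c, inner_zero_left, Real.cos_zero]
    ring
  rw [e]
  refine ⟨(h1.const_mul _).sub (h3.const_mul _), ?_⟩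
  rw [integral_sub (h1.const_mul _) (h3.const_mul _), integral_const_mul, integral_const_mul, h2, h4]
  have hc : c * (4 * Real.pi * t) ^ ((n : ℝ) / 2)
      = (2 * Real.sqrt Real.pi)⁻¹ * t ^ (-(3 / 2) : ℝ) := by
    simp only [c]
    rw [mul_assoc, ← Real.rpow_add (by positivity)]
    ring_nf; simp
  have he : Real.exp (-(omega m p ^ 2 * t)) = Real.exp (-(m ^ 2 * t)) * Real.exp (-(‖p‖ ^ 2 * t)) := by
    rw [← Real.exp_add, omega_sq]; ring_nf
  rw [he]
  simp only [norm_zero, ne_eq, OfNat.ofNat_ne_zero, not_false_eq_true, zero_pow, zero_mul, neg_zero,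
    Real.exp_zero, mul_one]
  linear_combination (1 - Real.exp (-(m ^ 2 * t)) * Real.exp (-(‖p‖ ^ 2 * t))) * hc

/-- The place where `1 ≤ n` matters: in dimension zero the origin is the whole space. -/
lemma ae_ne_zero (hn : 1 ≤ n) : ∀ᵐ x : E n, x ≠ 0 := by
  have : Nonempty (Fin n) := ⟨⟨0, hn⟩⟩
  have : Nontrivial (E n) := inferInstance
  rw [ae_iff]
  simp

/-- The energy is the Fourier integral of the kernel, regularized by the massless kernel. -/
theorem integral_subordKernel_sub {m : ℝ} (hm : 0 < m) (hn : 1 ≤ n) (p : E n) :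
    Integrable (fun x : E n => subordKernel 0 x - subordKernel m x * Real.cos ⟪p, x⟫_ℝ) ∧
    ∫ x : E n, (subordKernel 0 x - subordKernel m x * Real.cos ⟪p, x⟫_ℝ) = omega m p := by
  set H : E n × ℝ → ℝ := fun z =>
    heatWeight z.2 z.1 * (1 - Real.exp (-(m ^ 2 * z.2)) * Real.cos ⟪p, z.1⟫_ℝ) with hH
  have hmeas : Measurable H := measurable_heatWeight.mul (by fun_prop)
  have hnonneg : ∀ t : ℝ, 0 < t → ∀ x, 0 ≤ H (x, t) := by
    intro t ht x
    refine mul_nonneg (heatWeight_nonneg ht.le x) ?_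
    have h1 : Real.exp (-(m ^ 2 * t)) ≤ 1 := Real.exp_le_one_iff.2 (by
      have := mul_nonneg (sq_nonneg m) ht.le; linarith)
    have h2 := Real.cos_le_one ⟪p, x⟫_ℝ
    have h3 := Real.exp_pos (-(m ^ 2 * t))
    nlinarith
  have hωp : 0 < omega m p ^ 2 := by have := omega_pos hm p; positivity
  -- By nonnegativity the norm may be dropped, and the `x`-integral is the integrand of the square
  -- root formula, already known to be integrable in `t`.
  have hint : Integrable H (volume.prod (volume.restrict (Set.Ioi (0 : ℝ)))) := by
    rw [integrable_prod_iff' hmeas.aestronglyMeasurable]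
    constructor
    · filter_upwards [ae_restrict_mem measurableSet_Ioi] with t ht
      exact (integral_heatWeight_mul (m := m) ht p).1
    · refine ((integrableOn_rpow_mul_one_sub_exp hωp.le).const_mul
        (2 * Real.sqrt Real.pi)⁻¹).congr ?_
      filter_upwards [ae_restrict_mem measurableSet_Ioi] with t ht
      rw [← (integral_heatWeight_mul (m := m) ht p).2]
      exact integral_congr_ae (Eventually.of_forall fun x =>
        (Real.norm_of_nonneg (hnonneg t ht x)).symm)
  have hae : (fun x : E n => ∫ t in Set.Ioi (0 : ℝ), H (x, t)) =ᵐ[volume]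
      fun x => subordKernel 0 x - subordKernel m x * Real.cos ⟪p, x⟫_ℝ := by
    filter_upwards [ae_ne_zero hn] with x hx
    rw [subordKernel, subordKernel, ← integral_mul_const, ← integral_sub
      (heatWeight_mul_exp_integrableOn 0 hx) ((heatWeight_mul_exp_integrableOn m hx).mul_const _)]
    refine integral_congr_ae (Eventually.of_forall fun t => ?_)
    simp [hH]; ring
  refine ⟨hint.integral_prod_left.congr hae, ?_⟩
  rw [← integral_congr_ae hae, integral_integral_swap hint]
  have e : Set.EqOn (fun t => ∫ x : E n, H (x, t)) (fun t => (2 * Real.sqrt Real.pi)⁻¹ *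
        ((1 - Real.exp (-(omega m p ^ 2 * t))) * t ^ (-(3 / 2) : ℝ))) (Set.Ioi 0) :=
    fun t ht => (integral_heatWeight_mul (m := m) ht p).2
  rw [setIntegral_congr_fun measurableSet_Ioi e, integral_const_mul,
    integral_rpow_mul_one_sub_exp hωp, Real.sqrt_sq (omega_pos hm p).le]
  have : Real.sqrt Real.pi ≠ 0 := (Real.sqrt_pos.2 Real.pi_pos).ne'
  field_simp

/-! ### Truncation at distance `ε` and the pole `C/ε`. -/

lemma measurableSet_lt_norm (ε : ℝ) : MeasurableSet {x : E n | ε < ‖x‖} :=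
  measurableSet_lt measurable_const measurable_norm

lemma integrableOn_subordKernel_zero {ε : ℝ} (hε : 0 < ε) :
    IntegrableOn (subordKernel 0 : E n → ℝ) {x | ε < ‖x‖} := by
  obtain ⟨c, hc, h⟩ := exists_subordKernel_zero n
  -- The constant comes from `1 + |x| ≤ (1 + 1/ε)|x|` for `|x| > ε`.
  have h1 : Integrable (fun x : E n => c * (1 + 1 / ε) ^ ((n : ℝ) + 1) *
      (1 + ‖x‖) ^ (-((n : ℝ) + 1))) :=
    (integrable_one_add_norm (by simp)).const_mul _
  refine Integrable.mono' h1.integrableOn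
    (measurable_subordKernel 0).aestronglyMeasurable ?_
  filter_upwards [ae_restrict_mem (measurableSet_lt_norm ε)] with x hx
  have hx : ε < ‖x‖ := hx
  have h0 : 0 < ‖x‖ := hε.trans hx
  rw [Real.norm_of_nonneg (subordKernel_nonneg 0 x), h x (norm_pos_iff.1 h0), mul_assoc]
  gcongr
  rw [Real.rpow_neg h0.le, Real.rpow_neg (by positivity), ← div_eq_mul_inv, inv_eq_one_div,
    div_le_div_iff₀ (by positivity) (by positivity), one_mul, ← Real.mul_rpow (by positivity) h0.le]
  gcongr
  have : 1 ≤ 1 / ε * ‖x‖ := by rw [one_div, inv_mul_eq_div, one_le_div hε]; exact hx.le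
  linarith

lemma integrableOn_subordKernel (m : ℝ) {ε : ℝ} (hε : 0 < ε) :
    IntegrableOn (subordKernel m : E n → ℝ) {x | ε < ‖x‖} := by
  refine Integrable.mono' (integrableOn_subordKernel_zero hε)
    (measurable_subordKernel m).aestronglyMeasurable ?_
  filter_upwards [ae_restrict_mem (measurableSet_lt_norm ε)] with x hx
  rw [Real.norm_of_nonneg (subordKernel_nonneg m x)]
  exact subordKernel_le m (norm_pos_iff.1 (hε.trans hx))

-- Dilation by `ε`: the volume contributes `ε^n` and the homogeneous kernel `ε^{-(n+1)}`.
open scoped Pointwise in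
lemma setIntegral_subordKernel_zero {ε : ℝ} (hε : 0 < ε) :
    ∫ x in {x : E n | ε < ‖x‖}, subordKernel 0 x
      = (∫ x in {x : E n | 1 < ‖x‖}, subordKernel 0 x) / ε := by
  obtain ⟨c, hc, h⟩ := exists_subordKernel_zero n
  have h1 := Measure.setIntegral_comp_smul_of_pos (volume : Measure (E n)) (subordKernel 0)
    {x : E n | 1 < ‖x‖} hε
  have hs : ε • {x : E n | 1 < ‖x‖} = {x | ε < ‖x‖} := by
    ext x
    rw [Set.mem_smul_set_iff_inv_smul_mem₀ hε.ne']
    simp only [Set.mem_ofPred_eq, norm_smul, norm_inv, Real.norm_of_nonneg hε.le]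
    rw [inv_mul_eq_div, one_lt_div hε]
  rw [hs, finrank_euclideanSpace_fin] at h1
  have h2 : ∫ x in {x : E n | 1 < ‖x‖}, subordKernel 0 (ε • x)
      = ε ^ (-((n : ℝ) + 1)) * ∫ x in {x : E n | 1 < ‖x‖}, subordKernel 0 x := by
    rw [← integral_const_mul]
    refine setIntegral_congr_fun (measurableSet_lt_norm 1) fun x hx => ?_
    have hx0 : x ≠ 0 := norm_pos_iff.1 (one_pos.trans hx)
    beta_reduce
    rw [h x hx0, h _ (smul_ne_zero hε.ne' hx0), norm_smul, Real.norm_of_nonneg hε.le,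
      Real.mul_rpow hε.le (norm_nonneg _)]
    ring
  rw [h2, smul_eq_mul, Real.rpow_neg hε.le, Real.rpow_add_one hε.ne', Real.rpow_natCast] at h1
  have : ε ^ n ≠ 0 := by positivity
  field_simp at h1 ⊢
  linarith

/-- The Fourier integral of the kernel over the complement of the `ε`-ball. -/
noncomputable def truncFourier (m ε : ℝ) (p : E n) : ℝ :=
  ∫ x in {x : E n | ε < ‖x‖}, subordKernel m x * Real.cos ⟪p, x⟫_ℝ

lemma subordKernel_sub_nonneg (m : ℝ) (p : E n) {x : E n} (hx : x ≠ 0) :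
    0 ≤ subordKernel 0 x - subordKernel m x * Real.cos ⟪p, x⟫_ℝ := by
  have h1 := subordKernel_nonneg m x
  have h2 := subordKernel_le m hx
  have h3 := Real.cos_le_one ⟪p, x⟫_ℝ
  nlinarith

lemma integrableOn_subordKernel_mul_cos (m : ℝ) {ε : ℝ} (hε : 0 < ε) (p : E n) :
    IntegrableOn (fun x : E n => subordKernel m x * Real.cos ⟪p, x⟫_ℝ) {x | ε < ‖x‖} := by
  refine Integrable.mono (integrableOn_subordKernel m hε)
    ((measurable_subordKernel m).mul (by fun_prop)).aestronglyMeasurable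
    (Eventually.of_forall fun x => ?_)
  rw [norm_mul]
  exact mul_le_of_le_one_right (norm_nonneg _) (Real.abs_cos_le_one _)

lemma div_sub_truncFourier (m : ℝ) {ε : ℝ} (hε : 0 < ε) (p : E n) :
    (∫ x in {x : E n | 1 < ‖x‖}, subordKernel 0 x) / ε - truncFourier m ε p
      = ∫ x in {x : E n | ε < ‖x‖},
        (subordKernel 0 x - subordKernel m x * Real.cos ⟪p, x⟫_ℝ) := by
  rw [integral_sub (integrableOn_subordKernel_zero hε) (integrableOn_subordKernel_mul_cos m hε p),
    setIntegral_subordKernel_zero hε, truncFourier]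

/-- Truncating a nonnegative integrand only lowers its integral, whose full value is `ω_p`. The
bound is uniform in `ε` and serves as the majorant in `finitePart_omegaTilde`. -/
lemma abs_div_sub_truncFourier_le {m : ℝ} (hm : 0 < m) (hn : 1 ≤ n) {ε : ℝ} (hε : 0 < ε)
    (p : E n) :
    |(∫ x in {x : E n | 1 < ‖x‖}, subordKernel 0 x) / ε - truncFourier m ε p| ≤ omega m p := by
  obtain ⟨h1, h2⟩ := integral_subordKernel_sub hm hn p
  have h3 : 0 ≤ᵐ[volume] fun x : E n => subordKernel 0 x - subordKernel m x * Real.cos ⟪p, x⟫_ℝ := by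
    filter_upwards [ae_ne_zero hn] with x hx
    exact subordKernel_sub_nonneg m p hx
  rw [div_sub_truncFourier m hε, abs_of_nonneg (integral_nonneg_of_ae (ae_restrict_of_ae h3)), ← h2]
  exact setIntegral_le_integral h1 h3

lemma tendsto_div_sub_truncFourier {m : ℝ} (hm : 0 < m) (hn : 1 ≤ n) (p : E n) :
    Tendsto (fun ε : ℝ => (∫ x in {x : E n | 1 < ‖x‖}, subordKernel 0 x) / ε - truncFourier m ε p)
      (𝓝[>] 0) (𝓝 (omega m p)) := by
  obtain ⟨h1, h2⟩ := integral_subordKernel_sub hm hn p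
  rw [← h2]
  have h3 : Tendsto (fun ε : ℝ => ∫ x : E n, Set.indicator {x : E n | ε < ‖x‖}
      (fun x => subordKernel 0 x - subordKernel m x * Real.cos ⟪p, x⟫_ℝ) x) (𝓝[>] 0)
      (𝓝 (∫ x : E n, (subordKernel 0 x - subordKernel m x * Real.cos ⟪p, x⟫_ℝ))) := by
    refine tendsto_integral_filter_of_dominated_convergence _
      (Eventually.of_forall fun ε => h1.aestronglyMeasurable.indicator (measurableSet_lt_norm ε))
      (Eventually.of_forall fun ε => Eventually.of_forall fun x => norm_indicator_le_norm_self _ _)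
      h1.norm ?_
    filter_upwards [ae_ne_zero hn] with x hx
    refine tendsto_const_nhds.congr' ?_
    filter_upwards [Ioo_mem_nhdsGT (norm_pos_iff.2 hx)] with ε hε
    rw [Set.indicator_of_mem]
    exact hε.2
  refine h3.congr' ?_
  filter_upwards [self_mem_nhdsWithin] with ε hε
  rw [integral_indicator (measurableSet_lt_norm ε), div_sub_truncFourier m hε]

lemma continuous_truncFourier (m : ℝ) {ε : ℝ} (hε : 0 < ε) :
    Continuous (truncFourier m ε : E n → ℝ) := by
  unfold truncFourier
  refine continuous_of_dominated (bound := fun x => subordKernel m x) (fun p => ?_) (fun p => ?_)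
    (integrableOn_subordKernel m hε) ?_
  · exact (integrableOn_subordKernel_mul_cos m hε p).aestronglyMeasurable
  · refine Eventually.of_forall fun x => ?_
    rw [norm_mul, Real.norm_of_nonneg (subordKernel_nonneg m x)]
    exact mul_le_of_le_one_right (subordKernel_nonneg m x) (Real.abs_cos_le_one _)
  · exact Eventually.of_forall fun x => by fun_prop

/-- Kernel and region are even, so averaging over `x ↦ -x` removes the sine part. -/
lemma setIntegral_subordKernel_mul_exp (m : ℝ) {ε : ℝ} (hε : 0 < ε) (p : E n) :
    ∫ x in {x : E n | ε < ‖x‖}, (subordKernel m x : ℂ) * Complex.exp (⟪p, x⟫_ℝ * Complex.I)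
      = truncFourier m ε p := by
  set S := {x : E n | ε < ‖x‖}
  set f : E n → ℂ := fun x => (subordKernel m x : ℂ) * Complex.exp (⟪p, x⟫_ℝ * Complex.I)
  have hS : MeasurableSet S := measurableSet_lt_norm ε
  have hf : IntegrableOn f S := by
    refine Integrable.mono' (integrableOn_subordKernel m hε) ?_ (Eventually.of_forall fun x => ?_)
    · exact ((Complex.measurable_ofReal.comp (measurable_subordKernel m)).mul
        (by fun_prop)).aestronglyMeasurable
    · simp only [f]
      rw [norm_mul, Complex.norm_exp_ofReal_mul_I, mul_one, Complex.norm_real,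
        Real.norm_of_nonneg (subordKernel_nonneg m x)]
  have hneg : ∫ x in S, f x = ∫ x in S, f (-x) := by
    rw [← integral_indicator hS, ← integral_indicator hS, ← integral_neg_eq_self]
    refine integral_congr_ae (Eventually.of_forall fun x => ?_)
    simp [Set.indicator, S]
  have hf' : IntegrableOn (fun x => f (-x)) S := by
    have h := (hf.integrable_indicator hS).comp_neg
    rw [← integrable_indicator_iff hS]
    refine h.congr (Eventually.of_forall fun x => ?_)
    simp [Set.indicator, S]
  have h2 : ∫ x in S, (f x + f (-x)) = 2 * truncFourier m ε p := by
    rw [truncFourier, ← integral_complex_ofReal, ← integral_const_mul]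
    refine integral_congr_ae (Eventually.of_forall fun x => ?_)
    simp only [f, subordKernel_neg, inner_neg_right]
    push_cast
    rw [Complex.cos]
    ring_nf
  rw [integral_add hf hf', ← hneg, ← two_mul] at h2
  exact mul_left_cancel₀ two_ne_zero h2

/-- If `φ` is the Fourier integral of `h`, the finite part of `∫ ω̃ φ` is `∫ ω h`. -/
theorem finitePart_omegaTilde {m : ℝ} (hm : 0 < m) (hn : 1 ≤ n) {h : E n → ℂ} (hh : Integrable h)
    (hω : Integrable fun p => (omega m p : ℂ) * h p) :
    (∀ ε : ℝ, 0 < ε → IntegrableOn (fun x : E n => (omegaTilde m x : ℂ) *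
      ∫ p, Complex.exp (⟪p, x⟫_ℝ * Complex.I) * h p) {x | ε < ‖x‖}) ∧
    HasFinitePart (fun ε => ∫ x in {x : E n | ε < ‖x‖}, (omegaTilde m x : ℂ) *
      ∫ p, Complex.exp (⟪p, x⟫_ℝ * Complex.I) * h p) (∫ p, (omega m p : ℂ) * h p) := by
  set C := ∫ x in {x : E n | 1 < ‖x‖}, subordKernel 0 x
  -- Off the `ε`-ball the kernel is integrable and the phase has modulus one, so Fubini applies.
  have hprod : ∀ ε : ℝ, 0 < ε → Integrable (fun z : E n × E n =>
      (subordKernel m z.1 : ℂ) * (Complex.exp (⟪z.2, z.1⟫_ℝ * Complex.I) * h z.2))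
      ((volume.restrict {x : E n | ε < ‖x‖}).prod volume) := by
    intro ε hε
    have h1 := (integrableOn_subordKernel (n := n) m hε).integrable.ofReal (𝕜 := ℂ)
    refine (h1.mul_prod hh).mono ?_ (Eventually.of_forall fun z => ?_)
    · refine AEStronglyMeasurable.mul ?_ (AEStronglyMeasurable.mul ?_ ?_)
      · exact h1.aestronglyMeasurable.comp_fst
      · exact (by fun_prop : Continuous fun z : E n × E n =>
          Complex.exp (⟪z.2, z.1⟫_ℝ * Complex.I)).aestronglyMeasurable
      · exact hh.aestronglyMeasurable.comp_snd
    · simp only [norm_mul, Complex.norm_exp_ofReal_mul_I, one_mul]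
      exact le_rfl
  have hpt : ∀ ε : ℝ, 0 < ε → Set.EqOn (fun x : E n => (omegaTilde m x : ℂ) *
      ∫ p, Complex.exp (⟪p, x⟫_ℝ * Complex.I) * h p) (fun x => -∫ p, (subordKernel m x : ℂ) *
        (Complex.exp (⟪p, x⟫_ℝ * Complex.I) * h p)) {x | ε < ‖x‖} := by
    intro ε hε x hx
    beta_reduce
    rw [omegaTilde_eq hm (norm_pos_iff.1 (hε.trans hx)), integral_const_mul]
    push_cast; ring
  have hJ : ∀ ε : ℝ, 0 < ε → ∫ x in {x : E n | ε < ‖x‖}, (omegaTilde m x : ℂ) *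
      ∫ p, Complex.exp (⟪p, x⟫_ℝ * Complex.I) * h p = -∫ p, (truncFourier m ε p : ℂ) * h p := by
    intro ε hε
    rw [setIntegral_congr_fun (measurableSet_lt_norm ε) (hpt ε hε), integral_neg,
      integral_integral_swap (hprod ε hε)]
    congr 1
    refine integral_congr_ae (Eventually.of_forall fun p => ?_)
    beta_reduce
    rw [← setIntegral_subordKernel_mul_exp m hε p, ← integral_mul_const]
    simp only [mul_assoc]
  constructor
  · intro ε hε
    rw [integrableOn_congr_fun (hpt ε hε) (measurableSet_lt_norm ε)]
    exact (hprod ε hε).integral_prod_left.neg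
  -- The minus sign is that of `ω̃ = -S_m`: subtracting the pole leaves `∫ (C/ε - truncFourier) h`.
  · refine ⟨-C * ∫ p, h p, ?_⟩
    have key : Tendsto (fun ε : ℝ => ∫ p, ((C / ε - truncFourier m ε p : ℝ) : ℂ) * h p) (𝓝[>] 0)
        (𝓝 (∫ p, (omega m p : ℂ) * h p)) := by
      refine tendsto_integral_filter_of_dominated_convergence (fun p => ‖(omega m p : ℂ) * h p‖)
        ?_ ?_ hω.norm ?_
      · filter_upwards [self_mem_nhdsWithin] with ε hε
        have := continuous_truncFourier (n := n) m hε
        exact AEStronglyMeasurable.mul (Continuous.aestronglyMeasurable (by fun_prop))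
          hh.aestronglyMeasurable
      · filter_upwards [self_mem_nhdsWithin] with ε hε
        refine Eventually.of_forall fun p => ?_
        rw [norm_mul, norm_mul, Complex.norm_real, Complex.norm_real]
        gcongr
        rw [Real.norm_of_nonneg (omega_pos hm p).le]
        exact abs_div_sub_truncFourier_le hm hn hε p
      · refine Eventually.of_forall fun p => ?_
        exact ((Complex.continuous_ofReal.tendsto _).comp
          (tendsto_div_sub_truncFourier hm hn p)).mul_const _
    refine key.congr' ?_
    filter_upwards [self_mem_nhdsWithin] with ε hε
    rw [hJ ε hε]
    -- Follows from `|truncFourier| ≤ |C/ε| + ω`.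
    have hW : Integrable fun p => (truncFourier m ε p : ℂ) * h p := by
      refine ((hh.norm.const_mul ‖C / ε‖).add hω.norm).mono' ?_ (Eventually.of_forall fun p => ?_)
      · have := continuous_truncFourier (n := n) m hε
        exact AEStronglyMeasurable.mul (Continuous.aestronglyMeasurable (by fun_prop))
          hh.aestronglyMeasurable
      · simp only [Pi.add_apply, norm_mul, Complex.norm_real, ← add_mul]
        gcongr
        have h1 := abs_div_sub_truncFourier_le hm hn hε p
        rw [Real.norm_of_nonneg (omega_pos hm p).le]
        have h2 : truncFourier m ε p = C / ε - (C / ε - truncFourier m ε p) := by ring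
        rw [h2]
        exact (norm_sub_le _ _).trans (by gcongr; exact h1)
    have e : (fun p => ((C / ε - truncFourier m ε p : ℝ) : ℂ) * h p)
        = fun p => ((C / ε : ℝ) : ℂ) * h p - (truncFourier m ε p : ℂ) * h p := by
      funext p; push_cast; ring
    rw [e, integral_sub (hh.const_mul _) hW, integral_const_mul]
    push_cast; ring

/-! ### Schwartz maps with values in a normed space -/

section family

variable {V : Type*} [NormedAddCommGroup V] [NormedSpace ℝ V]

/-- The linear map `h ↦ ∑ j, h j • v j`. -/
noncomputable def gradCLM (v : Fin n → V) : E n →L[ℝ] V :=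
  ∑ j, ContinuousLinearMap.smulRightL ℝ (E n) V (EuclideanSpace.proj j) (v j)

lemma gradCLM_apply (v : Fin n → V) (h : E n) : gradCLM v h = ∑ j, h j • v j := by
  simp [gradCLM]

variable {ι : Type*} {F : ι → E n → V} {D : Fin n → ι → ι}

/-- A bootstrap: `D j i` is the index of the `j`-th partial derivative of `F i`, so the derivative
is built from members of the family, and the induction runs over all of them at once. -/
lemma contDiff_of_closed_family
    (hF : ∀ i p, HasFDerivAt (F i) (gradCLM fun j => F (D j i) p) p) (r : ℕ) (i : ι) :
    ContDiff ℝ r (F i) := by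
  induction r generalizing i with
  | zero => exact contDiff_zero.2 (continuous_iff_continuousAt.2 fun p => (hF i p).continuousAt)
  | succ r ih =>
    rw [show ((r + 1 : ℕ) : ℕ∞ω) = (r : ℕ∞ω) + 1 by push_cast; rfl]
    refine contDiff_succ_iff_fderiv.2 ⟨fun p => (hF i p).differentiableAt, by simp, ?_⟩
    have : fderiv ℝ (F i) = fun p => gradCLM fun j => F (D j i) p := funext fun p => (hF i p).fderiv
    rw [this]
    unfold gradCLM
    exact ContDiff.sum fun j _ => (ContinuousLinearMap.contDiff _).comp (ih (D j i))

lemma decay_of_closed_family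
    (hF : ∀ i p, HasFDerivAt (F i) (gradCLM fun j => F (D j i) p) p)
    (hdec : ∀ i N, ∃ C : ℝ, ∀ p, ‖p‖ ^ N * ‖F i p‖ ≤ C) (N r : ℕ) (i : ι) :
    ∃ C : ℝ, ∀ p, ‖p‖ ^ N * ‖iteratedFDeriv ℝ r (F i) p‖ ≤ C := by
  induction r generalizing i with
  | zero => simpa using hdec i N
  | succ r ih =>
    choose C hC using ih
    set L : Fin n → V →L[ℝ] (E n →L[ℝ] V) := fun j =>
      ContinuousLinearMap.smulRightL ℝ (E n) V (EuclideanSpace.proj j)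
    refine ⟨∑ j, ‖L j‖ * C (D j i), fun p => ?_⟩
    have e : fderiv ℝ (F i) = fun p => ∑ j, (L j ∘ F (D j i)) p := funext fun p => (hF i p).fderiv
    rw [← norm_iteratedFDeriv_fderiv, e, iteratedFDeriv_fun_sum_apply fun j _ =>
      ((L j).contDiff.comp (contDiff_of_closed_family hF r (D j i))).contDiffAt]
    calc _ ≤ ‖p‖ ^ N * ∑ j, ‖iteratedFDeriv ℝ r (L j ∘ F (D j i)) p‖ := by
          gcongr; exact norm_sum_le _ _
      _ ≤ ‖p‖ ^ N * ∑ j, ‖L j‖ * ‖iteratedFDeriv ℝ r (F (D j i)) p‖ := by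
          gcongr with j
          exact (L j).norm_iteratedFDeriv_comp_left
            (contDiff_of_closed_family hF r (D j i)).contDiffAt le_rfl
      _ = ∑ j, ‖L j‖ * (‖p‖ ^ N * ‖iteratedFDeriv ℝ r (F (D j i)) p‖) := by
          rw [Finset.mul_sum]; congr 1; ext j; ring
      _ ≤ _ := by gcongr with j; exact hC _ _

/-- A family of rapidly decreasing functions which is closed under partial derivatives consists
of Schwartz maps. -/
noncomputable def schwartzOfFamily
    (hF : ∀ i p, HasFDerivAt (F i) (gradCLM fun j => F (D j i) p) p)
    (hdec : ∀ i N, ∃ C : ℝ, ∀ p, ‖p‖ ^ N * ‖F i p‖ ≤ C) (i : ι) : 𝓢(E n, V) where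
  toFun := F i
  smooth' := contDiff_infty.2 fun r => contDiff_of_closed_family hF r i
  decay' N r := decay_of_closed_family hF hdec N r i

end family

/-! ### Slices of Schwartz functions as `L²`-valued Schwartz maps -/

/-- The `l`-th momentum displaced in the direction of the `j`-th axis. -/
noncomputable def axis {k : ℕ} (l : Fin k) (j : Fin n) : Fin k → E n :=
  Pi.single l (EuclideanSpace.single j 1)

/-- The partial derivative in the `j`-th component of the `l`-th momentum. -/
noncomputable def axisDeriv {k : ℕ} (l : Fin k) (j : Fin n) :
    𝓢(Fin k → E n, ℂ) →L[ℂ] 𝓢(Fin k → E n, ℂ) :=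
  LineDeriv.lineDerivOpCLM ℂ _ (axis l j)

lemma axisDeriv_apply {k : ℕ} (l : Fin k) (j : Fin n) (ψ : 𝓢(Fin k → E n, ℂ)) (P : Fin k → E n) :
    axisDeriv l j ψ P = fderiv ℝ ψ P (axis l j) := rfl

lemma cons_eq_single_add {k : ℕ} (q : E n) (P : Fin k → E n) :
    (Fin.cons q P : Fin (k + 1) → E n) = ContinuousLinearMap.single ℝ (fun _ => E n) 0 q
      + Fin.cons 0 P := by
  ext i
  refine Fin.cases ?_ (fun i => ?_) i <;> simp

lemma hasFDerivAt_cons {k : ℕ} (P : Fin k → E n) (q : E n) :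
    HasFDerivAt (fun q : E n => (Fin.cons q P : Fin (k + 1) → E n))
      (ContinuousLinearMap.single ℝ (fun _ => E n) 0) q := by
  have e : (fun q : E n => (Fin.cons q P : Fin (k + 1) → E n)) = fun q =>
      ContinuousLinearMap.single ℝ (fun _ => E n) 0 q + Fin.cons 0 P :=
    funext fun q => cons_eq_single_add q P
  rw [e]
  exact (ContinuousLinearMap.hasFDerivAt _).add_const _

lemma norm_tail_le_norm_cons {k : ℕ} (q : E n) (P : Fin k → E n) :
    ‖P‖ ≤ ‖(Fin.cons q P : Fin (k + 1) → E n)‖ :=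
  (pi_norm_le_iff_of_nonneg (norm_nonneg _)).2 fun i => by
    simpa using norm_le_pi_norm (Fin.cons q P : Fin (k + 1) → E n) i.succ

lemma norm_head_le_norm_cons {k : ℕ} (q : E n) (P : Fin k → E n) :
    ‖q‖ ≤ ‖(Fin.cons q P : Fin (k + 1) → E n)‖ := by
  simpa using norm_le_pi_norm (Fin.cons q P : Fin (k + 1) → E n) 0

lemma norm_single_le {k : ℕ} :
    ‖(ContinuousLinearMap.single ℝ (fun _ : Fin (k + 1) => E n) 0)‖ ≤ 1 :=
  ContinuousLinearMap.opNorm_le_bound _ zero_le_one fun q => by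
    rw [one_mul]
    refine (pi_norm_le_iff_of_nonneg (norm_nonneg _)).2 fun i => ?_
    by_cases hi : i = 0
    · subst hi; simp
    · simp [hi]

lemma fderiv_single_eq {k : ℕ} (ψ : 𝓢(Fin (k + 1) → E n, ℂ)) (Z : Fin (k + 1) → E n) (h : E n) :
    fderiv ℝ ψ Z (Pi.single 0 h) = ∑ j, h j • (axisDeriv 0 j ψ) Z := by
  have e : (Pi.single 0 h : Fin (k + 1) → E n) = ∑ j, h j • axis 0 j := by
    ext i l
    rw [Finset.sum_apply]
    by_cases hi : i = 0
    · subst hi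
      simp [axis, Pi.single_apply]
    · simp [axis, hi]
  rw [e, map_sum]
  simp [axisDeriv_apply]

/-- A Taylor estimate in the first momentum, uniform in the others with polynomial weight, so that
it survives the passage to the `L²` norm. The mean value inequality is used twice, with the second
derivative bounded by Schwartz decay. -/
lemma slice_taylor {k : ℕ} (ψ : 𝓢(Fin (k + 1) → E n, ℂ)) (i : ℕ) :
    ∃ C : ℝ, 0 ≤ C ∧ ∀ (p h : E n) (P : Fin k → E n),
      ‖P‖ ^ i * ‖ψ (Fin.cons (p + h) P) - ψ (Fin.cons p P)
        - ∑ j, h j • (axisDeriv 0 j ψ) (Fin.cons p P)‖ ≤ C * ‖h‖ ^ 2 := by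
  set ψ' : 𝓢(Fin (k + 1) → E n, (Fin (k + 1) → E n) →L[ℝ] ℂ) := SchwartzMap.fderivCLM ℝ (Fin (k + 1) → E n) ℂ ψ
  set ψ'' : 𝓢(Fin (k + 1) → E n, (Fin (k + 1) → E n) →L[ℝ] (Fin (k + 1) → E n) →L[ℝ] ℂ) := SchwartzMap.fderivCLM ℝ (Fin (k + 1) → E n) ((Fin (k + 1) → E n) →L[ℝ] ℂ) ψ'
  obtain ⟨C, hC0, hC⟩ := ψ''.decay i 0
  refine ⟨C, hC0.le, fun p h P => ?_⟩
  set ι : E n →L[ℝ] (Fin (k + 1) → E n) := ContinuousLinearMap.single ℝ (fun _ => E n) 0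
  have hι : ‖ι‖ ≤ 1 := norm_single_le
  set c : ℝ := ‖P‖ ^ i
  have hc : 0 ≤ c := by positivity
  -- The weight `c` depends only on `P`, hence is constant in the differentiated variable.
  have hG : ∀ q : E n, HasFDerivAt (fun q => c • ψ (Fin.cons q P))
      (c • (ψ' (Fin.cons q P)).comp ι) q := fun q =>
    ((ψ.hasFDerivAt _).comp q (hasFDerivAt_cons P q)).const_smul c
  have hG' : ∀ q : E n, HasFDerivAt (fun q : E n => c • ψ' (Fin.cons q P))
      (c • (ψ'' (Fin.cons q P)).comp ι) q := fun q =>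
    ((ψ'.hasFDerivAt _).comp q (hasFDerivAt_cons P q)).const_smul c
  have hb : ∀ q : E n, ‖c • (ψ'' (Fin.cons q P)).comp ι‖ ≤ C := by
    intro q
    refine (ContinuousLinearMap.opNorm_smul_le c _).trans ?_
    rw [Real.norm_of_nonneg hc]
    have h1 := hC (Fin.cons q P)
    rw [norm_iteratedFDeriv_zero] at h1
    refine le_trans ?_ h1
    have h2 : ‖(ψ'' (Fin.cons q P)).comp ι‖ ≤ ‖ψ'' (Fin.cons q P)‖ :=
      (ContinuousLinearMap.opNorm_comp_le _ _).trans (mul_le_of_le_one_right (norm_nonneg _) hι)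
    have h3 : c ≤ ‖(Fin.cons q P : Fin (k + 1) → E n)‖ ^ i :=
      pow_le_pow_left₀ (norm_nonneg _) (norm_tail_le_norm_cons q P) i
    gcongr
  have hlip : ∀ q : E n, ‖c • ψ' (Fin.cons q P) - c • ψ' (Fin.cons p P)‖ ≤ C * ‖q - p‖ := fun q =>
    convex_univ.norm_image_sub_le_of_norm_hasFDerivWithin_le
      (fun q _ => (hG' q).hasFDerivWithinAt) (fun q _ => hb q) (Set.mem_univ p) (Set.mem_univ q)
  -- On this ball the derivative differs from its value at `p` by at most `C‖h‖`, which yields the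
  -- quadratic remainder.
  have key := (convex_closedBall p ‖h‖).norm_image_sub_le_of_norm_hasFDerivWithin_le'
    (f := fun q => c • ψ (Fin.cons q P)) (φ := c • (ψ' (Fin.cons p P)).comp ι) (C := C * ‖h‖)
    (fun q _ => (hG q).hasFDerivWithinAt) (fun q hq => by
      have h1 := hlip q
      rw [← ContinuousLinearMap.smul_comp, ← ContinuousLinearMap.smul_comp,
        ← ContinuousLinearMap.sub_comp]
      refine (ContinuousLinearMap.opNorm_comp_le _ _).trans
        ((mul_le_of_le_one_right (norm_nonneg _) hι).trans (h1.trans ?_))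
      gcongr
      exact mem_closedBall_iff_norm.1 hq)
    (Metric.mem_closedBall_self (norm_nonneg _))
    (show p + h ∈ Metric.closedBall p ‖h‖ by simp)
  have e : ψ' (Fin.cons p P) (ι h) = ∑ j, h j • (axisDeriv 0 j ψ) (Fin.cons p P) :=
    fderiv_single_eq ψ _ h
  rw [add_sub_cancel_left, smul_apply, ContinuousLinearMap.comp_apply, e,
    ← smul_sub, ← smul_sub, norm_smul, Real.norm_of_nonneg hc] at key
  rw [pow_two, ← mul_assoc]
  exact key

variable (m : ℝ) [Fact (0 < m)]

/-- Finitely many weighted suprema, without derivatives, control the `L²` norm; this converts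
pointwise estimates on slices into norm estimates. -/
lemma exists_norm_toLp_le (n k : ℕ) : ∃ (M : ℕ) (K : ℝ), 0 ≤ K ∧
    ∀ (f : 𝓢(Fin k → E n, ℂ)) (B : ℝ), 0 ≤ B → (∀ i ≤ M, ∀ P, ‖P‖ ^ i * ‖f P‖ ≤ B) →
      ‖f.toLp 2 (muPi n m k)‖ ≤ K * B := by
  obtain ⟨M, K, hK, h⟩ := SchwartzMap.norm_toLp_le_seminorm ℝ (E := Fin k → E n) ℂ 2 (muPi n m k)
  refine ⟨M, K, hK, fun f B hB hf => (h f).trans ?_⟩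
  gcongr
  refine Seminorm.finset_sup_apply_le hB fun i hi => ?_
  rw [Finset.mem_Iic, Prod.le_def] at hi
  have h2 : i.2 = 0 := Nat.le_zero.1 hi.2
  rw [SchwartzMap.schwartzSeminormFamily_apply, h2]
  exact SchwartzMap.seminorm_le_bound ℝ _ _ f hB fun P => by
    rw [norm_iteratedFDeriv_zero]; exact hf _ hi.1 P

/-- The slice `ψ(p, ·)` as a vector of `L²`. -/
noncomputable def sliceLp (k : ℕ) (ψ : 𝓢(Fin (k + 1) → E n, ℂ)) (p : E n) :
    Lp ℂ 2 (muPi n m k) :=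
  (slice p k ψ).toLp 2 (muPi n m k)

lemma hasFDerivAt_sliceLp (k : ℕ) (ψ : 𝓢(Fin (k + 1) → E n, ℂ)) (p : E n) :
    HasFDerivAt (sliceLp m k ψ) (gradCLM fun j => sliceLp m k (axisDeriv 0 j ψ) p) p := by
  obtain ⟨M, K, hK, hM⟩ := exists_norm_toLp_le m n k
  choose C hC0 hC using slice_taylor ψ
  rw [hasFDerivAt_iff_isLittleO_nhds_zero]
  have hO : (fun h : E n => sliceLp m k ψ (p + h) - sliceLp m k ψ p
      - gradCLM (fun j => sliceLp m k (axisDeriv 0 j ψ) p) h) =O[𝓝 0] fun h => ‖h‖ ^ 2 := by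
    refine Asymptotics.IsBigO.of_bound (K * ∑ i ∈ Finset.range (M + 1), C i)
      (Eventually.of_forall fun h => ?_)
    have e : sliceLp m k ψ (p + h) - sliceLp m k ψ p
        - gradCLM (fun j => sliceLp m k (axisDeriv 0 j ψ) p) h
        = (slice (p + h) k ψ - slice p k ψ - ∑ j, h j • slice p k (axisDeriv 0 j ψ)).toLp 2
          (muPi n m k) := by
      change _ = SchwartzMap.toLpCLM ℝ ℂ 2 (muPi n m k) _
      rw [map_sub, map_sub, map_sum, gradCLM_apply]
      simp only [map_smul]
      rfl
    rw [e, norm_pow, norm_norm, mul_assoc]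
    refine hM _ _ (mul_nonneg (Finset.sum_nonneg fun i _ => hC0 i) (by positivity)) fun i hi P => ?_
    have h1 := hC i p h P
    refine le_trans ?_ (h1.trans (mul_le_mul_of_nonneg_right
      (Finset.single_le_sum (fun i _ => hC0 i) (Finset.mem_range.2 (Nat.lt_succ_of_le hi)))
      (by positivity)))
    simp [slice_apply]
  refine hO.trans_isLittleO ?_
  exact Asymptotics.isLittleO_norm_pow_id one_lt_two

/-- `‖p‖^N ‖P‖^i` is at most the `(N+i)`-th power of the norm of the joint momentum, where `ψ`
decays. -/
lemma sliceLp_decay (k : ℕ) (ψ : 𝓢(Fin (k + 1) → E n, ℂ)) (N : ℕ) :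
    ∃ C : ℝ, ∀ p, ‖p‖ ^ N * ‖sliceLp m k ψ p‖ ≤ C := by
  obtain ⟨M, K, hK, hM⟩ := exists_norm_toLp_le m n k
  choose C hC0 hC using fun i => ψ.decay (N + i) 0
  refine ⟨K * ∑ i ∈ Finset.range (M + 1), C i, fun p => ?_⟩
  have h := hM ((‖p‖ ^ N) • slice p k ψ) (∑ i ∈ Finset.range (M + 1), C i)
    (Finset.sum_nonneg fun i _ => (hC0 i).le) (fun i hi P => ?_)
  · have e : ((‖p‖ ^ N) • slice p k ψ).toLp 2 (muPi n m k) = (‖p‖ ^ N) • sliceLp m k ψ p :=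
      (SchwartzMap.toLpCLM ℝ ℂ 2 (muPi n m k)).map_smul _ _
    rwa [e, norm_smul, norm_pow, norm_norm] at h
  · have h1 := hC i (Fin.cons p P)
    rw [norm_iteratedFDeriv_zero] at h1
    refine le_trans ?_ (h1.trans
      (Finset.single_le_sum (fun i _ => (hC0 i).le) (Finset.mem_range.2 (Nat.lt_succ_of_le hi))))
    rw [smul_apply, norm_smul, norm_pow, norm_norm, slice_apply, pow_add, ← mul_assoc,
      mul_comm (‖P‖ ^ i)]
    gcongr
    · exact norm_head_le_norm_cons p P
    · exact norm_tail_le_norm_cons p P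

/-- The slices of a Schwartz function form an `L²`-valued Schwartz map. -/
noncomputable def sliceSchwartz (k : ℕ) (ψ : 𝓢(Fin (k + 1) → E n, ℂ)) :
    𝓢(E n, Lp ℂ 2 (muPi n m k)) :=
  schwartzOfFamily (F := sliceLp m k) (D := fun j ψ => axisDeriv 0 j ψ)
    (hasFDerivAt_sliceLp m k) (sliceLp_decay m k) ψ

lemma sliceSchwartz_apply (k : ℕ) (ψ : 𝓢(Fin (k + 1) → E n, ℂ)) (p : E n) :
    sliceSchwartz m k ψ p = (slice p k ψ).toLp 2 (muPi n m k) := rfl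

lemma lineDerivOp_sliceSchwartz (k : ℕ) (ψ : 𝓢(Fin (k + 1) → E n, ℂ)) (j : Fin n) :
    ∂_{(EuclideanSpace.single j 1 : E n)} (sliceSchwartz m k ψ)
      = sliceSchwartz m k (axisDeriv 0 j ψ) := by
  ext1 p
  rw [SchwartzMap.lineDerivOp_apply_eq_fderiv]
  have h : fderiv ℝ (sliceSchwartz m k ψ) p = _ := (hasFDerivAt_sliceLp m k ψ p).fderiv
  rw [h, gradCLM_apply, Finset.sum_eq_single j]
  · simp; rfl
  · intro i _ hi
    simp [hi]
  · simp

/-! ### The Fock space -/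

section Fock

variable (m : ℝ)

/-- Symmetrization, followed by the inclusion of the `k`-particle space into the Fock space. -/
noncomputable def fockIncl (n : ℕ) (k : ℕ) : Lp ℂ 2 (muPi n m k) →L[ℂ] FockSpace n m :=
  (lp.singleContinuousLinearMap ℂ (fun k : ℕ => kParticle n m k) 2 k).comp
    (kParticle n m k).orthogonalProjectionOnto

lemma fockIncl_apply {k : ℕ} {u : Lp ℂ 2 (muPi n m k)} (hu : u ∈ kParticle n m k) :
    fockIncl m n k u = lp.single (E := fun k : ℕ => kParticle n m k) 2 k ⟨u, hu⟩ := by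
  have : (kParticle n m k).orthogonalProjectionOnto u = ⟨u, hu⟩ :=
    (kParticle n m k).orthogonalProjectionOnto_mem_subspace_eq_self ⟨u, hu⟩
  exact congrArg (lp.single (E := fun k : ℕ => kParticle n m k) 2 k) this

/-- The projection is self-adjoint, so a symmetric left entry sees the right entry unchanged;
symmetry of the right entry need never be checked. -/
lemma inner_fockIncl {k l : ℕ} {u : Lp ℂ 2 (muPi n m k)} (hu : u ∈ kParticle n m k)
    (v : (l : ℕ) → Lp ℂ 2 (muPi n m l)) :
    ⟪fockIncl m n k u, fockIncl m n l (v l)⟫_ℂ = if k = l then ⟪u, v k⟫_ℂ else 0 := by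
  have h : ⟪fockIncl m n k u, fockIncl m n l (v l)⟫_ℂ
      = ⟪(⟨u, hu⟩ : kParticle n m k), (lp.single (E := fun k : ℕ => kParticle n m k) 2 l
        ((kParticle n m l).orthogonalProjectionOnto (v l))) k⟫_ℂ := by
    rw [fockIncl_apply m hu]
    exact lp.inner_single_left _ _ _
  rw [h]
  split_ifs with hkl
  · subst hkl
    rw [lp.single_apply_self]
    have h2 := (kParticle n m k).starProjection_inner_eq_zero (v k) u hu
    rw [← inner_conj_symm, map_eq_zero, inner_sub_right, sub_eq_zero] at h2
    exact h2.symm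
  · rw [lp.single_apply_ne _ _ _ hkl, inner_zero_right]

lemma inner_sum_fockIncl (S : Finset ℕ) (u v : (k : ℕ) → Lp ℂ 2 (muPi n m k))
    (hu : ∀ k, u k ∈ kParticle n m k) :
    ⟪∑ k ∈ S, fockIncl m n k (u k), ∑ k ∈ S, fockIncl m n k (v k)⟫_ℂ
      = ∑ k ∈ S, ⟪u k, v k⟫_ℂ := by
  rw [sum_inner]
  refine Finset.sum_congr rfl fun k hk => ?_
  rw [inner_sum]
  simp_rw [inner_fockIncl m (hu k) v]
  simp [hk]

variable [Fact (0 < m)]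

lemma toFock_eq_sum {N : ℕ} {X : SchwartzDomain n} (hN : ∀ k, N ≤ k → X.1 k = 0) :
    toFock m X = ∑ k ∈ Finset.range N, fockIncl m n k ((X.1 k).toLp 2 (muPi n m k)) := by
  have h1 : ∀ k, fockIncl m n k ((X.1 k).toLp 2 (muPi n m k))
      = lp.single (E := fun k : ℕ => kParticle n m k) 2 k ⟨_, toLp_mem_kParticle X k⟩ :=
    fun k => fockIncl_apply m (toLp_mem_kParticle X k)
  simp_rw [h1]
  refine lp.ext (E := fun k : ℕ => kParticle n m k) (funext fun k => ?_)
  have h2 : ((∑ k ∈ Finset.range N, lp.single (E := fun k : ℕ => kParticle n m k) 2 k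
      ⟨(X.1 k).toLp 2 (muPi n m k), toLp_mem_kParticle X k⟩ :
        lp (fun k : ℕ => kParticle n m k) 2) : (k : ℕ) → kParticle n m k) k
      = ∑ l ∈ Finset.range N, (lp.single (E := fun k : ℕ => kParticle n m k) 2 l
      ⟨(X.1 l).toLp 2 (muPi n m l), toLp_mem_kParticle X l⟩) k := by
    rw [lp.coeFn_sum, Finset.sum_apply]
  refine Eq.trans ?_ h2.symm
  by_cases hk : k < N
  · rw [Finset.sum_eq_single k]
    · rw [lp.single_apply_self]; rfl
    · intro l _ hl
      exact lp.single_apply_ne _ _ _ hl.symm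
    · simp [hk]
  · rw [Finset.sum_eq_zero]
    · refine Subtype.ext ?_
      change (X.1 k).toLp 2 (muPi n m k) = 0
      rw [hN k (not_lt.1 hk)]
      exact (SchwartzMap.toLpCLM ℂ ℂ 2 (muPi n m k)).map_zero
    · intro l hl
      exact lp.single_apply_ne _ _ _ (by rintro rfl; exact hk (Finset.mem_range.1 hl))

lemma exists_particle_bound (X : SchwartzDomain n) : ∃ N : ℕ, ∀ k, N ≤ k → X.1 k = 0 := by
  obtain ⟨N, hN⟩ := X.2.1.bddAbove
  refine ⟨N + 1, fun k hk => ?_⟩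
  by_contra hc
  have := hN hc
  omega

lemma isOpenPosMeasure_muMeas : (muMeas n m).IsOpenPosMeasure := by
  refine Measure.AbsolutelyContinuous.isOpenPosMeasure (μ := (volume : Measure (E n))) ?_
  refine withDensity_absolutelyContinuous' ?_ ?_
  · have := continuous_omega (n := n) m
    exact Measurable.aemeasurable (by fun_prop)
  · refine Eventually.of_forall fun p => ?_
    have := omega_pos (n := n) (Fact.out : 0 < m) p
    simpa using this

/-- The measure has positive density, so continuous functions that agree almost everywhere agree. -/
lemma toFock_injective : Function.Injective (toFock m : SchwartzDomain n →ₗ[ℂ] FockSpace n m) := by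
  intro X Y h
  refine Subtype.ext (funext fun k => ?_)
  have := isOpenPosMeasure_muMeas (n := n) m
  have : (muPi n m k).IsOpenPosMeasure := by unfold muPi; infer_instance
  refine SchwartzMap.injective_toLp 2 (muPi n m k) ?_
  exact congrArg (fun F : FockSpace n m => ((F.1 k : kParticle n m k) : Lp ℂ 2 (muPi n m k))) h

/-- An operator on Schwartz states is determined by its matrix elements. -/
lemma eq_of_inner_toFock {T T' : SchwartzDomain n →ₗ[ℂ] SchwartzDomain n}
    (h : ∀ Φ Ψ, ⟪toFock m Φ, toFock m (T Ψ)⟫_ℂ = ⟪toFock m Φ, toFock m (T' Ψ)⟫_ℂ) : T = T' := by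
  refine LinearMap.ext fun Ψ => toFock_injective m (sub_eq_zero.1 ?_)
  have h1 := h (T Ψ - T' Ψ) Ψ
  rw [← sub_eq_zero, ← inner_sub_right, map_sub] at h1
  exact inner_self_eq_zero.1 h1

end Fock

/-! ### The annihilation operators as Fock space valued Schwartz maps -/

section annihilation

variable (m : ℝ) [Fact (0 < m)]

/-- The family `∑_{k<N} √(k+1) ψ_{k+1}(p, ·)` of Fock space vectors. -/
noncomputable def sliceSum (N : ℕ) (ψ : (k : ℕ) → 𝓢(Fin (k + 1) → E n, ℂ)) :
    𝓢(E n, FockSpace n m) :=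
  ∑ k ∈ Finset.range N, SchwartzMap.postcompCLM (fockIncl m n k)
    (((Real.sqrt (k + 1) : ℝ) : ℂ) • sliceSchwartz m k (ψ k))

lemma sliceSum_apply (N : ℕ) (ψ : (k : ℕ) → 𝓢(Fin (k + 1) → E n, ℂ)) (p : E n) :
    sliceSum m N ψ p = ∑ k ∈ Finset.range N,
      fockIncl m n k (((Real.sqrt (k + 1) : ℝ) : ℂ) • sliceSchwartz m k (ψ k) p) := by
  simp [sliceSum]

lemma lineDerivOp_postcompCLM {V W : Type*} [NormedAddCommGroup V] [NormedSpace ℂ V]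
    [NormedSpace ℝ V] [IsScalarTower ℝ ℂ V] [NormedAddCommGroup W] [NormedSpace ℂ W] (L : V →L[ℂ] W) (f : 𝓢(E n, V)) (v : E n) :
    ∂_{v} (SchwartzMap.postcompCLM L f) = SchwartzMap.postcompCLM L (∂_{v} f) := by
  ext1 p
  rw [SchwartzMap.postcompCLM_apply, SchwartzMap.lineDerivOp_apply_eq_fderiv,
    SchwartzMap.lineDerivOp_apply_eq_fderiv]
  have h := ((L.restrictScalars ℝ).hasFDerivAt.comp p (f.hasFDerivAt p)).fderiv
  exact congrArg (fun T : E n →L[ℝ] W => T v) h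

lemma lineDerivOp_sliceSum (N : ℕ) (ψ : (k : ℕ) → 𝓢(Fin (k + 1) → E n, ℂ)) (j : Fin n) :
    ∂_{(EuclideanSpace.single j 1 : E n)} (sliceSum m N ψ)
      = sliceSum m N fun k => axisDeriv 0 j (ψ k) := by
  unfold sliceSum
  rw [LineDeriv.lineDerivOp_sum]
  refine Finset.sum_congr rfl fun k _ => ?_
  rw [lineDerivOp_postcompCLM, LineDeriv.lineDerivOp_smul, lineDerivOp_sliceSchwartz]

/-- The Schwartz map `p ↦ a_c(p)Ψ`. -/
noncomputable def annCov (Ψ : SchwartzDomain n) : 𝓢(E n, FockSpace n m) :=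
  sliceSum m (exists_particle_bound Ψ).choose fun k => Ψ.1 (k + 1)

lemma sliceSum_eq_toFock {N : ℕ} {Ψ : SchwartzDomain n} (hN : ∀ k, N ≤ k → Ψ.1 k = 0) (p : E n) :
    sliceSum m N (fun k => Ψ.1 (k + 1)) p = toFock m (annihilationCov p Ψ) := by
  rw [toFock_eq_sum m (N := N) (fun k hk => ?_), sliceSum_apply]
  · refine Finset.sum_congr rfl fun k _ => congrArg _ ?_
    exact ((SchwartzMap.toLpCLM ℂ ℂ 2 (muPi n m k)).map_smul _ _).symm
  · change ((Real.sqrt (k + 1) : ℝ) : ℂ) • slice p k (Ψ.1 (k + 1)) = 0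
    rw [hN (k + 1) (by omega), map_zero, smul_zero]

lemma annCov_apply (Ψ : SchwartzDomain n) (p : E n) :
    annCov m Ψ p = toFock m (annihilationCov p Ψ) :=
  sliceSum_eq_toFock m (exists_particle_bound Ψ).choose_spec p

lemma annCov_eq_sliceSum {N : ℕ} {Ψ : SchwartzDomain n} (hN : ∀ k, N ≤ k → Ψ.1 k = 0) :
    annCov m Ψ = sliceSum m N fun k => Ψ.1 (k + 1) := by
  ext1 p
  rw [annCov_apply, sliceSum_eq_toFock m hN]

lemma sliceSchwartz_mem_kParticle (Ψ : SchwartzDomain n) (k : ℕ) (p : E n) :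
    sliceSchwartz m k (Ψ.1 (k + 1)) p ∈ kParticle n m k := by
  have h := toLp_mem_kParticle (m := m) (annihilationCov p Ψ) k
  have e : ((annihilationCov p Ψ).1 k).toLp 2 (muPi n m k)
      = ((Real.sqrt (k + 1) : ℝ) : ℂ) • sliceSchwartz m k (Ψ.1 (k + 1)) p :=
    (SchwartzMap.toLpCLM ℂ ℂ 2 (muPi n m k)).map_smul _ _
  rw [e] at h
  refine ((kParticle n m k).smul_mem_iff ?_).1 h
  exact_mod_cast (Real.sqrt_pos.2 (by positivity)).ne'

/-- The two factors `√(k+1)` combine to `k + 1`, which will match the `k + 1` equal one-particle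
contributions of `dGamma`. -/
lemma inner_annCov_sliceSum {N : ℕ} {Φ : SchwartzDomain n} (hN : ∀ k, N ≤ k → Φ.1 k = 0)
    (ψ : (k : ℕ) → 𝓢(Fin (k + 1) → E n, ℂ)) (p : E n) :
    ⟪annCov m Φ p, sliceSum m N ψ p⟫_ℂ = ∑ k ∈ Finset.range N, ((k : ℂ) + 1) *
      ⟪sliceSchwartz m k (Φ.1 (k + 1)) p, sliceSchwartz m k (ψ k) p⟫_ℂ := by
  rw [annCov_eq_sliceSum m hN, sliceSum_apply, sliceSum_apply, inner_sum_fockIncl m _ _ _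
    fun k => (kParticle n m k).smul_mem _ (sliceSchwartz_mem_kParticle m Φ k p)]
  refine Finset.sum_congr rfl fun k _ => ?_
  rw [inner_smul_left, inner_smul_right, Complex.conj_ofReal, ← mul_assoc, ← Complex.ofReal_mul,
    Real.mul_self_sqrt (by positivity)]
  push_cast; rfl

lemma integrable_inner_schwartz {V : Type*} [NormedAddCommGroup V] [InnerProductSpace ℂ V]
    [NormedSpace ℝ V] (f g : 𝓢(E n, V)) : Integrable fun p => ⟪f p, g p⟫_ℂ := by
  obtain ⟨C, -, hC⟩ := f.decay 0 0
  refine (g.integrable.norm.const_mul C).mono'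
    (f.continuous.inner g.continuous).aestronglyMeasurable (Eventually.of_forall fun p => ?_)
  have h := hC p
  simp only [pow_zero, one_mul, norm_iteratedFDeriv_zero] at h
  exact (norm_inner_le_norm _ _).trans (by gcongr)

end annihilation

/-! ### Second quantized vector fields -/

section secondQuantization

lemma hasTemperateGrowth_comp_proj {g : E n → ℂ} (hg : g.HasTemperateGrowth) {k : ℕ} (l : Fin k) :
    Function.HasTemperateGrowth fun P : Fin k → E n => g (P l) :=
  hg.comp (ContinuousLinearMap.proj (R := ℝ) (φ := fun _ : Fin k => E n) l).hasTemperateGrowth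

/-- The vector field `g ∂/∂p^j` acting on the `l`-th momentum. -/
noncomputable def fieldAt (g : E n → ℂ) (j : Fin n) {k : ℕ} (l : Fin k) :
    𝓢(Fin k → E n, ℂ) →L[ℂ] 𝓢(Fin k → E n, ℂ) :=
  (SchwartzMap.smulLeftCLM ℂ fun P : Fin k → E n => g (P l)).comp (axisDeriv l j)

variable {g : E n → ℂ} (j : Fin n)

lemma fieldAt_apply (hg : g.HasTemperateGrowth) {k : ℕ} (l : Fin k) (ψ : 𝓢(Fin k → E n, ℂ)) (P : Fin k → E n) :
    fieldAt g j l ψ P = g (P l) * axisDeriv l j ψ P := by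
  rw [fieldAt, ContinuousLinearMap.comp_apply,
    SchwartzMap.smulLeftCLM_apply_apply (hasTemperateGrowth_comp_proj hg l), smul_eq_mul]

/-- Chain rule for the permutation of momenta, which carries the axis of particle `σ l` to that of
particle `l`. Hence the sum over all particles is symmetric. -/
lemma fieldAt_perm (hg : g.HasTemperateGrowth) {k : ℕ} {ψ : 𝓢(Fin k → E n, ℂ)} (σ : Equiv.Perm (Fin k))
    (hψ : ∀ P, ψ (P ∘ σ) = ψ P) (l : Fin k) (P : Fin k → E n) :
    fieldAt g j l ψ (P ∘ σ) = fieldAt g j (σ l) ψ P := by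
  rw [fieldAt_apply j hg, fieldAt_apply j hg, axisDeriv_apply, axisDeriv_apply]
  let L : (Fin k → E n) →L[ℝ] (Fin k → E n) :=
    ContinuousLinearMap.pi fun i => ContinuousLinearMap.proj (σ i)
  have h1 : HasFDerivAt ψ ((fderiv ℝ ψ (P ∘ σ)).comp L) P := by
    have h := HasFDerivAt.comp P (f := L) (g := ψ) (ψ.hasFDerivAt (L P)) L.hasFDerivAt
    have e : (ψ ∘ L : (Fin k → E n) → ℂ) = ψ := funext hψ
    rw [e] at h
    exact h
  rw [h1.fderiv]
  have h2 : L (axis (σ l) j) = axis l j := by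
    ext1 i
    change (axis (σ l) j : Fin k → E n) (σ i) = axis l j i
    by_cases hi : i = l
    · subst hi; simp [axis]
    · simp [axis, hi]
  rw [ContinuousLinearMap.comp_apply, h2]
  rfl

/-- The second quantization `∑_l g(p_l) ∂/∂p_l^j` of the vector field `g ∂/∂p^j`. -/
noncomputable def dGamma (hg : g.HasTemperateGrowth) : SchwartzDomain n →ₗ[ℂ] SchwartzDomain n where
  toFun Ψ := ⟨fun k => ∑ l : Fin k, fieldAt g j l (Ψ.1 k), by
    refine ⟨Ψ.2.1.subset fun k hk hc => hk (by simp [hc]), fun k σ P => ?_⟩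
    simp only [sum_apply]
    simp_rw [fieldAt_perm j hg σ (Ψ.2.2 k σ)]
    exact Equiv.sum_comp σ fun l => fieldAt g j l (Ψ.1 k) P⟩
  map_add' Ψ Φ := by
    refine Subtype.ext (funext fun k => ?_)
    simp [Finset.sum_add_distrib]
  map_smul' c Ψ := by
    refine Subtype.ext (funext fun k => ?_)
    simp [Finset.smul_sum]

lemma dGamma_apply (hg : g.HasTemperateGrowth) (Ψ : SchwartzDomain n) (k : ℕ) :
    (dGamma j hg Ψ).1 k = ∑ l : Fin k, fieldAt g j l (Ψ.1 k) := rfl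

variable (m : ℝ)

/-- Identical particles contribute equally: change variables by the transposition of `0` and `l`. -/
lemma integral_inner_fieldAt (hg : g.HasTemperateGrowth) (Φ Ψ : SchwartzDomain n) (k : ℕ)
    (l : Fin (k + 1)) :
    ∫ Z, ⟪Φ.1 (k + 1) Z, fieldAt g j l (Ψ.1 (k + 1)) Z⟫_ℂ ∂(muPi n m (k + 1))
      = ∫ Z, ⟪Φ.1 (k + 1) Z, fieldAt g j 0 (Ψ.1 (k + 1)) Z⟫_ℂ ∂(muPi n m (k + 1)) := by
  have hσ := measurePreserving_perm (n := n) m (k + 1) (Equiv.swap 0 l)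
  have hc : Continuous fun Z => ⟪Φ.1 (k + 1) Z, fieldAt g j 0 (Ψ.1 (k + 1)) Z⟫_ℂ :=
    (Φ.1 (k + 1)).continuous.inner (fieldAt g j 0 (Ψ.1 (k + 1))).continuous
  have h := integral_map hσ.aemeasurable (hc.aestronglyMeasurable (μ := (muPi n m (k + 1)).map _))
  rw [hσ.map_eq] at h
  rw [h]
  refine integral_congr_ae (Eventually.of_forall fun Z => ?_)
  beta_reduce
  rw [Φ.2.2, fieldAt_perm j hg _ (Ψ.2.2 _ _), Equiv.swap_apply_left]

variable [Fact (0 < m)]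

lemma integral_muMeas (f : E n → ℂ) :
    ∫ p, f p ∂(muMeas n m) = ∫ p, (((2 * omega m p)⁻¹ : ℝ) : ℂ) * f p := by
  have h0 := continuous_omega (n := n) m
  rw [muMeas, integral_withDensity_eq_integral_toReal_smul (by fun_prop)
    (Eventually.of_forall fun p => ENNReal.ofReal_lt_top)]
  refine integral_congr_ae (Eventually.of_forall fun p => ?_)
  have := omega_pos (n := n) (Fact.out : 0 < m) p
  beta_reduce
  rw [ENNReal.toReal_ofReal (by positivity), Complex.real_smul, one_div]

lemma integrable_inner_muPi {k : ℕ} (φ χ : 𝓢(Fin k → E n, ℂ)) :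
    Integrable (fun P => ⟪φ P, χ P⟫_ℂ) (muPi n m k) := by
  obtain ⟨C, -, hC⟩ := φ.decay 0 0
  refine ((χ.integrable (μ := muPi n m k)).norm.const_mul C).mono'
    (φ.continuous.inner χ.continuous).aestronglyMeasurable (Eventually.of_forall fun p => ?_)
  have h := hC p
  simp only [pow_zero, one_mul, norm_iteratedFDeriv_zero] at h
  exact (norm_inner_le_norm _ _).trans (by gcongr)

/-- Fubini, splitting off the first momentum, whose density is `1/(2ω)`. -/
lemma integral_muPi_succ {k : ℕ} (φ χ : 𝓢(Fin (k + 1) → E n, ℂ)) :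
    ∫ Z, ⟪φ Z, χ Z⟫_ℂ ∂(muPi n m (k + 1))
      = ∫ p, (((2 * omega m p)⁻¹ : ℝ) : ℂ) * ⟪sliceSchwartz m k φ p, sliceSchwartz m k χ p⟫_ℂ := by
  have hmp := measurePreserving_piFinSuccAbove (α := fun _ : Fin (k + 1) => E n)
    (fun _ => muMeas n m) 0
  have hint := integrable_inner_muPi m φ χ
  have h1 := hmp.symm.integral_comp' (g := fun Z => ⟪φ Z, χ Z⟫_ℂ)
  have h2 := (hmp.symm.integrable_comp_emb (MeasurableEquiv.measurableEmbedding _)).2 hint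
  refine h1.symm.trans ?_
  refine (integral_prod _ h2).trans ?_
  rw [integral_muMeas]
  refine integral_congr_ae (Eventually.of_forall fun p => ?_)
  beta_reduce
  congr 1
  rw [sliceSchwartz_apply, sliceSchwartz_apply, SchwartzMap.inner_toL2_toL2_eq _ _ (muPi n m k)]
  refine integral_congr_ae (Eventually.of_forall fun P => ?_)
  have e : (MeasurableEquiv.piFinSuccAbove (fun _ : Fin (k + 1) => E n) 0).symm (p, P)
      = Fin.cons p P := by
    ext1 i
    refine Fin.cases ?_ (fun i => ?_) i <;> simp [MeasurableEquiv.piFinSuccAbove]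
  simp only [Function.comp_apply, e, slice_apply]

lemma sliceSchwartz_fieldAt (hg : g.HasTemperateGrowth) {k : ℕ} (ψ : 𝓢(Fin (k + 1) → E n, ℂ))
    (p : E n) :
    sliceSchwartz m k (fieldAt g j 0 ψ) p = g p • sliceSchwartz m k (axisDeriv 0 j ψ) p := by
  have e : slice p k (fieldAt g j 0 ψ) = g p • slice p k (axisDeriv 0 j ψ) := by
    ext1 P
    rw [slice_apply, fieldAt_apply j hg, smul_apply, slice_apply, Fin.cons_zero, smul_eq_mul]
  rw [sliceSchwartz_apply, e]
  exact (SchwartzMap.toLpCLM ℂ ℂ 2 (muPi n m k)).map_smul _ _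

lemma integrable_inv_omega_mul {f : E n → ℂ} (hf : Integrable f) :
    Integrable fun p => (((2 * omega m p)⁻¹ : ℝ) : ℂ) * f p := by
  have hm : 0 < m := Fact.out
  have h0 := continuous_omega (n := n) m
  have h1 : Continuous fun p : E n => (((2 * omega m p)⁻¹ : ℝ) : ℂ) :=
    Complex.continuous_ofReal.comp ((continuous_const.mul h0).inv₀ fun p => by
      have := omega_pos hm p; exact (by positivity : (0 : ℝ) < 2 * omega m p).ne')
  refine (hf.norm.const_mul (2 * m)⁻¹).mono' (h1.aestronglyMeasurable.mul hf.aestronglyMeasurable)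
    (Eventually.of_forall fun p => ?_)
  have h2 : m ≤ omega m p := Real.le_sqrt_of_sq_le (by nlinarith [sq_nonneg ‖p‖])
  have h3 := omega_pos hm p
  rw [norm_mul, Complex.norm_real, Real.norm_of_nonneg (by positivity)]
  gcongr

/-- Matrix elements of the second quantization of the vector field `g ∂/∂p^j`. -/
theorem inner_toFock_dGamma (hg : g.HasTemperateGrowth) (Φ Ψ : SchwartzDomain n) :
    ⟪toFock m Φ, toFock m (dGamma j hg Ψ)⟫_ℂ = ∫ p, (((2 * omega m p)⁻¹ : ℝ) : ℂ) *
      (g p * ⟪annCov m Φ p, ∂_{(EuclideanSpace.single j 1 : E n)} (annCov m Ψ) p⟫_ℂ) := by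
  obtain ⟨N₁, h₁⟩ := exists_particle_bound Φ
  obtain ⟨N₂, h₂⟩ := exists_particle_bound Ψ
  set N := max N₁ N₂
  have hΦ : ∀ k, N ≤ k → Φ.1 k = 0 := fun k hk => h₁ k ((le_max_left _ _).trans hk)
  have hΨ : ∀ k, N ≤ k → Ψ.1 k = 0 := fun k hk => h₂ k ((le_max_right _ _).trans hk)
  have hT : ∀ k, N + 1 ≤ k → (dGamma j hg Ψ).1 k = 0 := fun k hk => by
    rw [dGamma_apply, hΨ k (by omega)]; simp
  have hterm : ∀ k : ℕ, ⟪(Φ.1 (k + 1)).toLp 2 (muPi n m (k + 1)),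
      ((dGamma j hg Ψ).1 (k + 1)).toLp 2 (muPi n m (k + 1))⟫_ℂ
      = ∫ p, (((2 * omega m p)⁻¹ : ℝ) : ℂ) * (((k : ℂ) + 1) *
        (g p * ⟪sliceSchwartz m k (Φ.1 (k + 1)) p,
          sliceSchwartz m k (axisDeriv 0 j (Ψ.1 (k + 1))) p⟫_ℂ)) := by
    intro k
    have h3 : ∀ Z, ⟪Φ.1 (k + 1) Z, (dGamma j hg Ψ).1 (k + 1) Z⟫_ℂ
        = ∑ l, ⟪Φ.1 (k + 1) Z, fieldAt g j l (Ψ.1 (k + 1)) Z⟫_ℂ := by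
      intro Z
      rw [dGamma_apply, sum_apply, inner_sum]
    rw [SchwartzMap.inner_toL2_toL2_eq _ _ (muPi n m (k + 1))]
    simp_rw [h3]
    rw [integral_finsetSum _ fun l _ => integrable_inner_muPi m _ _]
    simp_rw [integral_inner_fieldAt j m hg Φ Ψ k]
    rw [Finset.sum_const, Finset.card_univ, Fintype.card_fin, nsmul_eq_mul, integral_muPi_succ,
      ← integral_const_mul]
    refine integral_congr_ae (Eventually.of_forall fun p => ?_)
    beta_reduce
    rw [sliceSchwartz_fieldAt j m hg, inner_smul_right]
    push_cast; ring
  -- One more term than needed, so that removing the vacuum leaves exactly the slices `k < N`.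
  rw [toFock_eq_sum m (N := N + 1) (fun k hk => hΦ k (by omega)), toFock_eq_sum m hT,
    inner_sum_fockIncl m _ _ _ (toLp_mem_kParticle Φ), Finset.sum_range_succ']
  -- With no particles the sum defining `dGamma` is empty.
  have h0 : ⟪(Φ.1 0).toLp 2 (muPi n m 0), ((dGamma j hg Ψ).1 0).toLp 2 (muPi n m 0)⟫_ℂ = 0 := by
    rw [SchwartzMap.inner_toL2_toL2_eq _ _ (muPi n m 0), dGamma_apply]
    simp
  rw [h0, add_zero, Finset.sum_congr rfl fun k _ => hterm k, ← integral_finsetSum]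
  · refine integral_congr_ae (Eventually.of_forall fun p => ?_)
    beta_reduce
    rw [annCov_eq_sliceSum m hΨ, lineDerivOp_sliceSum, inner_annCov_sliceSum m hΦ, ← Finset.mul_sum,
      Finset.mul_sum _ _ (g p)]
    congr 1
    refine Finset.sum_congr rfl fun k _ => ?_
    ring
  · intro k _
    refine integrable_inv_omega_mul m (Integrable.const_mul ?_ _)
    refine (integrable_inner_schwartz (sliceSchwartz m k (Φ.1 (k + 1)))
      (sliceSchwartz m k (fieldAt g j 0 (Ψ.1 (k + 1))))).congr (Eventually.of_forall fun p => ?_)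
    beta_reduce
    rw [sliceSchwartz_fieldAt j m hg, inner_smul_right]

end secondQuantization

/-! ### The generators in momentum space -/

section energy

variable (m : ℝ) [Fact (0 < m)]

/-- Scaling by the mass reduces to powers of `1 + |p|²`. -/
lemma hasTemperateGrowth_norm_sq_add_rpow (s : ℝ) :
    Function.HasTemperateGrowth fun p : E n => (‖p‖ ^ 2 + m ^ 2) ^ s := by
  have hm : 0 < m := Fact.out
  have e : (fun p : E n => (‖p‖ ^ 2 + m ^ 2) ^ s)
      = fun p : E n => (m ^ 2) ^ s * (1 + ‖m⁻¹ • p‖ ^ 2) ^ s := by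
    funext p
    rw [← Real.mul_rpow (by positivity) (by positivity), norm_smul, Real.norm_of_nonneg (by positivity)]
    congr 1
    field_simp
    ring
  rw [e]
  refine (Function.HasTemperateGrowth.const _).mul ?_
  exact (Function.hasTemperateGrowth_one_add_norm_sq_rpow (E n) s).comp
    (m⁻¹ • ContinuousLinearMap.id ℝ (E n)).hasTemperateGrowth

lemma hasTemperateGrowth_omega : Function.HasTemperateGrowth fun p : E n => (omega m p : ℂ) := by
  have e : (fun p : E n => (omega m p : ℂ)) = fun p : E n =>
      (((‖p‖ ^ 2 + m ^ 2) ^ (1 / 2 : ℝ) : ℝ) : ℂ) := by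
    funext p; rw [omega, Real.sqrt_eq_rpow]
  rw [e]
  exact Function.Complex.hasTemperateGrowth_ofReal.comp (hasTemperateGrowth_norm_sq_add_rpow m _)

lemma hasTemperateGrowth_inv_sqrt_omega :
    Function.HasTemperateGrowth fun p : E n => (((Real.sqrt (2 * omega m p))⁻¹ : ℝ) : ℂ) := by
  have e : (fun p : E n => (((Real.sqrt (2 * omega m p))⁻¹ : ℝ) : ℂ)) = fun p : E n =>
      (((Real.sqrt 2)⁻¹ * (‖p‖ ^ 2 + m ^ 2) ^ (-(1 / 4) : ℝ) : ℝ) : ℂ) := by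
    funext p
    have h0 : (0 : ℝ) ≤ ‖p‖ ^ 2 + m ^ 2 := by positivity
    rw [Real.sqrt_mul zero_le_two, omega, Real.sqrt_eq_rpow (‖p‖ ^ 2 + m ^ 2),
      Real.sqrt_eq_rpow (_ ^ (_ : ℝ)), ← Real.rpow_mul h0, mul_inv, ← Real.rpow_neg h0]
    norm_num
  rw [e]
  exact Function.Complex.hasTemperateGrowth_ofReal.comp
    ((Function.HasTemperateGrowth.const _).mul (hasTemperateGrowth_norm_sq_add_rpow m _))

lemma hasTemperateGrowth_coord (j : Fin n) :
    Function.HasTemperateGrowth fun p : E n => ((p j : ℝ) : ℂ) :=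
  Function.Complex.hasTemperateGrowth_ofReal.comp
    (EuclideanSpace.proj j : E n →L[ℝ] ℝ).hasTemperateGrowth

lemma hasFDerivAt_omega (p : E n) :
    HasFDerivAt (omega m : E n → ℝ) ((omega m p)⁻¹ • innerSL ℝ p) p := by
  have hp := omega_pos (n := n) (Fact.out : 0 < m) p
  have h1 : HasFDerivAt (fun p : E n => ‖p‖ ^ 2 + m ^ 2) (2 • innerSL ℝ p) p :=
    (hasStrictFDerivAt_norm_sq p).hasFDerivAt.add_const _
  have h0 : ‖p‖ ^ 2 + m ^ 2 ≠ 0 := by rw [← omega_sq]; positivity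
  have h2 := h1.sqrt h0
  refine h2.congr_fderiv ?_
  ext v
  change (1 / (2 * omega m p)) • ((2 • innerSL ℝ p) v) = (omega m p)⁻¹ • (innerSL ℝ p v)
  simp only [smul_apply, smul_eq_mul, nsmul_eq_mul]
  field_simp
  push_cast
  ring

lemma hasFDerivAt_inv_sqrt_omega (p : E n) :
    HasFDerivAt (fun p : E n => (Real.sqrt (2 * omega m p))⁻¹)
      (-((Real.sqrt (2 * omega m p))⁻¹ / (2 * omega m p ^ 2)) • innerSL ℝ p) p := by
  have hp := omega_pos (n := n) (Fact.out : 0 < m) p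
  have h1 := ((hasFDerivAt_omega m p).const_mul 2).sqrt (by positivity)
  have hs : 0 < Real.sqrt (2 * omega m p) := Real.sqrt_pos.2 (by positivity)
  have h2 := (hasDerivAt_inv hs.ne').comp_hasFDerivAt p h1
  refine h2.congr_fderiv ?_
  ext v
  simp only [smul_apply, smul_eq_mul]
  have h3 : Real.sqrt (2 * omega m p) ^ 2 = 2 * omega m p := Real.sq_sqrt (by positivity)
  rw [h3]
  field_simp

end energy

/-! ### The generators as second quantized vector fields. -/

section annihilation

variable (m : ℝ) [Fact (0 < m)]

/-- The Schwartz map `p ↦ a(p)Ψ`. -/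
noncomputable def annSchwartz (Ψ : SchwartzDomain n) : 𝓢(E n, FockSpace n m) :=
  SchwartzMap.smulLeftCLM (FockSpace n m)
    (fun p : E n => (((Real.sqrt (2 * omega m p))⁻¹ : ℝ) : ℂ)) (annCov m Ψ)

lemma annSchwartz_apply (Ψ : SchwartzDomain n) (p : E n) : annSchwartz m Ψ p = ann m p Ψ := by
  rw [annSchwartz, SchwartzMap.smulLeftCLM_apply_apply (hasTemperateGrowth_inv_sqrt_omega m),
    annCov_apply, ann]

lemma coe_annSchwartz (Ψ : SchwartzDomain n) :
    (annSchwartz m Ψ : E n → FockSpace n m) = fun p => ann m p Ψ :=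
  funext (annSchwartz_apply m Ψ)

lemma partialDeriv_schwartz {V : Type*} [NormedAddCommGroup V] [NormedSpace ℝ V] (f : 𝓢(E n, V))
    (j : Fin n) (p : E n) :
    partialDeriv j f p = ∂_{(EuclideanSpace.single j 1 : E n)} f p := rfl

lemma partialDeriv_ann (Ψ : SchwartzDomain n) (j : Fin n) (p : E n) :
    partialDeriv j (fun q => ann m q Ψ) p = (((Real.sqrt (2 * omega m p))⁻¹ : ℝ) : ℂ) •
      (∂_{(EuclideanSpace.single j 1 : E n)} (annCov m Ψ) p
        - ((p j / (2 * omega m p ^ 2) : ℝ) : ℂ) • annCov m Ψ p) := by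
  have h1 := hasFDerivAt_inv_sqrt_omega m p
  have h2 := h1.smul ((annCov m Ψ).hasFDerivAt p)
  have e : (fun q => ann m q Ψ)
      = fun q : E n => (Real.sqrt (2 * omega m q))⁻¹ • annCov m Ψ q := by
    funext q
    rw [ann, annCov_apply, Complex.coe_smul]
  rw [partialDeriv, e]
  have h3 := h2.fderiv
  rw [SchwartzMap.lineDerivOp_apply_eq_fderiv]
  have h4 := congrArg (fun T : E n →L[ℝ] FockSpace n m => T (EuclideanSpace.single j 1)) h3
  refine h4.trans ?_
  simp only [add_apply, smul_apply, ContinuousLinearMap.smulRight_apply,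
    innerSL_apply_apply, smul_sub, ← Complex.coe_smul, smul_smul]
  rw [sub_eq_add_neg, ← neg_smul]
  congr 2
  simp [EuclideanSpace.inner_single_right]
  ring

lemma inv_sqrt_omega_mul_self (p : E n) :
    (((Real.sqrt (2 * omega m p))⁻¹ : ℝ) : ℂ) * (((Real.sqrt (2 * omega m p))⁻¹ : ℝ) : ℂ)
      = (((2 * omega m p)⁻¹ : ℝ) : ℂ) := by
  have hp := omega_pos (n := n) (Fact.out : 0 < m) p
  rw [← Complex.ofReal_mul, ← mul_inv, Real.mul_self_sqrt (by positivity)]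

lemma inner_ann_smul (Φ : SchwartzDomain n) (p : E n) (c : ℂ) (v : FockSpace n m) :
    ⟪ann m p Φ, ((((Real.sqrt (2 * omega m p))⁻¹ : ℝ) : ℂ) * c) • v⟫_ℂ
      = (((2 * omega m p)⁻¹ : ℝ) : ℂ) * (c * ⟪annCov m Φ p, v⟫_ℂ) := by
  rw [ann, inner_smul_left, inner_smul_right, Complex.conj_ofReal, ← annCov_apply,
    ← inv_sqrt_omega_mul_self]
  ring

/-- Differentiating `(2ω)^{-1/2}` and multiplying by `-ω` gives `+p^j/(2ω)`, which cancels
`p_j/(2ω)` because `p_j = -p^j`. -/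
lemma boost_integrand (Φ Ψ : SchwartzDomain n) (j : Fin n) (p : E n) :
    ⟪ann m p Φ, ((covComp p j / (2 * omega m p) : ℝ) : ℂ) • ann m p Ψ
        - ((omega m p : ℝ) : ℂ) • partialDeriv j (fun q => ann m q Ψ) p⟫_ℂ
      = (((2 * omega m p)⁻¹ : ℝ) : ℂ) * (-(omega m p : ℂ) *
        ⟪annCov m Φ p, ∂_{(EuclideanSpace.single j 1 : E n)} (annCov m Ψ) p⟫_ℂ) := by
  have hp := omega_pos (n := n) (Fact.out : 0 < m) p
  rw [← inner_ann_smul]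
  congr 1
  rw [partialDeriv_ann, ann, ← annCov_apply]
  have hp' : (omega m p : ℂ) ≠ 0 := by exact_mod_cast hp.ne'
  simp only [smul_sub, smul_smul, covComp]
  rw [sub_sub_eq_add_sub, add_sub_assoc, ← sub_eq_zero]
  match_scalars
  · field_simp
    ring
  · field_simp
    ring

/-- Here the derivatives of `(2ω)^{-1/2}` contribute `p_i p^k - p_k p^i = 0`: a rotation preserves
`ω`. -/
lemma rotation_integrand (Φ Ψ : SchwartzDomain n) (i k : Fin n) (p : E n) :
    ⟪ann m p Φ, ((covComp p i : ℝ) : ℂ) • partialDeriv k (fun q => ann m q Ψ) p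
        - ((covComp p k : ℝ) : ℂ) • partialDeriv i (fun q => ann m q Ψ) p⟫_ℂ
      = (((2 * omega m p)⁻¹ : ℝ) : ℂ) * (-(p i : ℂ) *
          ⟪annCov m Φ p, ∂_{(EuclideanSpace.single k 1 : E n)} (annCov m Ψ) p⟫_ℂ)
        + (((2 * omega m p)⁻¹ : ℝ) : ℂ) * ((p k : ℂ) *
          ⟪annCov m Φ p, ∂_{(EuclideanSpace.single i 1 : E n)} (annCov m Ψ) p⟫_ℂ) := by
  rw [← inner_ann_smul, ← inner_ann_smul, ← inner_add_right]
  congr 1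
  rw [partialDeriv_ann, partialDeriv_ann]
  simp only [smul_sub, smul_smul, covComp]
  rw [← sub_eq_zero]
  match_scalars <;> ring

/-- The inner product of Schwartz maps remains integrable after multiplication by `g / (2ω)`. -/
lemma integrable_inv_omega_mul_inner {g : E n → ℂ} (hg : g.HasTemperateGrowth)
    (f h : 𝓢(E n, FockSpace n m)) :
    Integrable fun p => (((2 * omega m p)⁻¹ : ℝ) : ℂ) * (g p * ⟪f p, h p⟫_ℂ) := by
  refine integrable_inv_omega_mul m ((integrable_inner_schwartz f
    (SchwartzMap.smulLeftCLM (FockSpace n m) g h)).congr (Eventually.of_forall fun p => ?_))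
  beta_reduce
  rw [SchwartzMap.smulLeftCLM_apply_apply hg, inner_smul_right]

theorem exists_boostGenerator (j : Fin n) :
    ∃ T : SchwartzDomain n →ₗ[ℂ] SchwartzDomain n, IsBoostGenerator m j T := by
  have hg : Function.HasTemperateGrowth fun p : E n => -(omega m p : ℂ) :=
    (hasTemperateGrowth_omega m).neg
  refine ⟨Complex.I • dGamma j hg, fun Φ Ψ => ?_⟩
  simp_rw [boost_integrand]
  refine ⟨integrable_inv_omega_mul_inner m hg _ _, ?_⟩
  rw [LinearMap.smul_apply, map_smul, inner_smul_right, inner_toFock_dGamma]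

theorem exists_rotationGenerator (i k : Fin n) :
    ∃ T : SchwartzDomain n →ₗ[ℂ] SchwartzDomain n, IsRotationGenerator m i k T := by
  have hi : Function.HasTemperateGrowth fun p : E n => -((p i : ℝ) : ℂ) :=
    (hasTemperateGrowth_coord i).neg
  have hk := hasTemperateGrowth_coord k
  refine ⟨Complex.I • (dGamma k hi + dGamma i hk), fun Φ Ψ => ?_⟩
  have h1 := integrable_inv_omega_mul_inner m hi (annCov m Φ)
    (∂_{(EuclideanSpace.single k 1 : E n)} (annCov m Ψ))
  have h2 := integrable_inv_omega_mul_inner m hk (annCov m Φ)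
    (∂_{(EuclideanSpace.single i 1 : E n)} (annCov m Ψ))
  simp_rw [rotation_integrand]
  refine ⟨h1.add h2, ?_⟩
  rw [integral_add h1 h2, LinearMap.smul_apply, map_smul, inner_smul_right, LinearMap.add_apply,
    map_add, inner_add_right, inner_toFock_dGamma, inner_toFock_dGamma]

theorem existsUnique_boostGenerator (j : Fin n) :
    ∃! T : SchwartzDomain n →ₗ[ℂ] SchwartzDomain n, IsBoostGenerator m j T :=
  existsUnique_of_exists_of_unique (exists_boostGenerator m j) fun _ _ h h' =>
    eq_of_inner_toFock m fun Φ Ψ => (h Φ Ψ).2.trans (h' Φ Ψ).2.symm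

theorem existsUnique_rotationGenerator (i k : Fin n) :
    ∃! T : SchwartzDomain n →ₗ[ℂ] SchwartzDomain n, IsRotationGenerator m i k T :=
  existsUnique_of_exists_of_unique (exists_rotationGenerator m i k) fun _ _ h h' =>
    eq_of_inner_toFock m fun Φ Ψ => (h Φ Ψ).2.trans (h' Φ Ψ).2.symm

end annihilation

/-! ### The Fourier transform to coordinate space -/

/-- The signature flips the sign, so the transform to coordinate space is the inverse Fourier
transform, up to a dilation by `2π`. -/
lemma exp_contract (p x : E n) :
    Complex.exp (-Complex.I * (contract p x : ℝ)) = Complex.exp (⟪p, x⟫_ℝ * Complex.I) := by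
  have : contract p x = -⟪p, x⟫_ℝ := by
    simp [contract, covComp, PiLp.inner_apply, mul_comm]
  rw [this]
  congr 1
  push_cast; ring

/-- The dilation `x ↦ x / (2π)`. -/
noncomputable def dilation (n : ℕ) : E n ≃L[ℝ] E n :=
  ContinuousLinearEquiv.smulLeft (Units.mk0 (2 * Real.pi)⁻¹ (by positivity : (2 * Real.pi)⁻¹ ≠ 0))

lemma dilation_apply (x : E n) : dilation n x = (2 * Real.pi)⁻¹ • x := rfl

section coordFT

variable {V : Type*} [NormedAddCommGroup V] [InnerProductSpace ℂ V]

/-- The Fourier transform `(2π)^{-n/2} ∫ dⁿp e^{-i p_k x^k} f(p)`. -/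
noncomputable def coordFT (f : 𝓢(E n, V)) : 𝓢(E n, V) :=
  (((2 * Real.pi) ^ (-(n : ℝ) / 2) : ℝ) : ℂ) •
    SchwartzMap.compCLMOfContinuousLinearEquiv ℂ (dilation n) (𝓕⁻ f)

lemma coordFT_eq (f : 𝓢(E n, V)) (x : E n) :
    coordFT f x = (((2 * Real.pi) ^ (-(n : ℝ) / 2) : ℝ) : ℂ) • (𝓕⁻ f) ((2 * Real.pi)⁻¹ • x) :=
  rfl

lemma coordFT_apply (f : 𝓢(E n, V)) (x : E n) :
    coordFT f x = (((2 * Real.pi) ^ (-(n : ℝ) / 2) : ℝ) : ℂ) •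
      ∫ p : E n, Complex.exp (-Complex.I * (contract p x : ℝ)) • f p := by
  rw [coordFT_eq, SchwartzMap.fourierInv_coe, Real.fourierInv_eq']
  congr 1
  refine integral_congr_ae (Eventually.of_forall fun p => ?_)
  beta_reduce
  rw [exp_contract, inner_smul_right, mul_inv_cancel_left₀ (by positivity)]

lemma coordFT_smul (c : ℂ) (f : 𝓢(E n, V)) : coordFT (c • f) = c • coordFT f := by
  unfold coordFT
  rw [FourierTransform.fourierInv_smul, map_smul, smul_comm]

lemma coordFT_sub (f g : 𝓢(E n, V)) : coordFT (f - g) = coordFT f - coordFT g := by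
  have h : 𝓕⁻ (f - g) = 𝓕⁻ f - 𝓕⁻ g :=
    map_sub (AddMonoidHom.mk' (𝓕⁻ : 𝓢(E n, V) → 𝓢(E n, V)) FourierTransform.fourierInv_add) f g
  unfold coordFT
  rw [h, map_sub, smul_sub]

/-- Multiplication by the `j`-th coordinate. -/
noncomputable def mulCoord (j : Fin n) (f : 𝓢(E n, V)) : 𝓢(E n, V) :=
  SchwartzMap.smulLeftCLM V (fun p : E n => ((p j : ℝ) : ℂ)) f

lemma mulCoord_apply (j : Fin n) (f : 𝓢(E n, V)) (p : E n) :
    mulCoord j f p = ((p j : ℝ) : ℂ) • f p :=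
  SchwartzMap.smulLeftCLM_apply_apply (hasTemperateGrowth_coord j) f p

lemma smulLeftCLM_inner_apply (v : E n) (f : 𝓢(E n, V)) (p : E n) :
    SchwartzMap.smulLeftCLM V (fun p : E n => ⟪p, v⟫_ℝ) f p = ⟪p, v⟫_ℝ • f p :=
  SchwartzMap.smulLeftCLM_apply_apply (by fun_prop) f p

lemma lineDerivOp_coordFT (k : Fin n) (f : 𝓢(E n, V)) :
    ∂_{(EuclideanSpace.single k 1 : E n)} (coordFT f) = coordFT (Complex.I • mulCoord k f) := by
  unfold coordFT
  rw [LineDeriv.lineDerivOp_smul, SchwartzMap.lineDerivOp_compCLMOfContinuousLinearEquiv,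
    SchwartzMap.lineDerivOp_fourierInv_eq]
  congr 3
  ext1 p
  rw [smul_apply, smul_apply, smulLeftCLM_inner_apply, mulCoord_apply, dilation_apply,
    inner_smul_right, EuclideanSpace.inner_single_right, ← Complex.coe_smul, smul_smul, smul_smul]
  congr 1
  have : (Real.pi : ℂ) ≠ 0 := by exact_mod_cast Real.pi_ne_zero
  simp
  field_simp

/-- With the phase `e^{ip·x}`, multiplication by `x^j` corresponds to `i∂/∂p^j`. -/
lemma coord_smul_coordFT (j : Fin n) (f : 𝓢(E n, V)) (x : E n) :
    ((x j : ℝ) : ℂ) • coordFT f x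
      = coordFT (Complex.I • ∂_{(EuclideanSpace.single j 1 : E n)} f) x := by
  rw [coordFT_smul, smul_apply, coordFT_eq, coordFT_eq, SchwartzMap.fourierInv_lineDerivOp_eq,
    smul_apply, smulLeftCLM_inner_apply, inner_smul_left, EuclideanSpace.inner_single_right,
    ← Complex.coe_smul]
  simp only [smul_smul]
  congr 1
  have : (Real.pi : ℂ) ≠ 0 := by exact_mod_cast Real.pi_ne_zero
  simp
  field_simp
  rw [Complex.I_sq]
  ring

variable [CompleteSpace V]

lemma fourier_translate (f : 𝓢(E n, V)) (a p : E n) :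
    𝓕 (SchwartzMap.compSubConstCLM ℂ (-a) (𝓕⁻ f)) p
      = Complex.exp ((2 * Real.pi * ⟪a, p⟫_ℝ : ℝ) * Complex.I) • f p := by
  have h := congrFun (VectorFourier.fourierIntegral_comp_add_right Real.fourierChar
    (volume : Measure (E n)) (innerₗ (E n)) (𝓕⁻ f : 𝓢(E n, V)) a) p
  have e : (SchwartzMap.compSubConstCLM ℂ (-a) (𝓕⁻ f) : E n → V)
      = (𝓕⁻ f : 𝓢(E n, V)) ∘ fun v => v + a := by
    funext v; simp
  rw [SchwartzMap.fourier_coe, e]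
  refine h.trans ?_
  have h2 : VectorFourier.fourierIntegral Real.fourierChar (volume : Measure (E n)) (innerₗ (E n))
      (𝓕⁻ f : 𝓢(E n, V)) p = f p := by
    have h3 : 𝓕 (𝓕⁻ f) = f := FourierTransform.fourier_fourierInv_eq f
    exact congrArg (fun g : 𝓢(E n, V) => g p) h3
  rw [h2, Circle.smul_def, Real.fourierChar_apply]
  rfl

/-- Plancherel's identity with a translation. -/
lemma integral_inner_coordFT_translate (f g : 𝓢(E n, V)) (u : E n) :
    ∫ x, ⟪coordFT f x, coordFT g (x + u)⟫_ℂ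
      = ∫ p, Complex.exp (⟪p, u⟫_ℝ * Complex.I) * ⟪f p, g p⟫_ℂ := by
  set a := (2 * Real.pi)⁻¹ • u with ha
  set G := SchwartzMap.compSubConstCLM ℂ (-a) (𝓕⁻ g)
  have h1 := SchwartzMap.integral_sesq_fourier_fourier (𝓕⁻ f) G (innerSL ℂ)
  -- The two normalizations cancel the Jacobian `(2π)^n` of the dilation.
  have hc : (((2 * Real.pi) ^ (-(n : ℝ) / 2) : ℝ) : ℂ) * (((2 * Real.pi) ^ (-(n : ℝ) / 2) : ℝ) : ℂ)
      * (((2 * Real.pi) ^ n : ℝ) : ℂ) = 1 := by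
    rw [← Complex.ofReal_mul, ← Complex.ofReal_mul, ← Real.rpow_add (by positivity),
      ← Real.rpow_natCast, ← Real.rpow_add (by positivity)]
    ring_nf
    simp
  have h2 : ∀ x, ⟪coordFT f x, coordFT g (x + u)⟫_ℂ
      = (((2 * Real.pi) ^ (-(n : ℝ) / 2) : ℝ) : ℂ) * (((2 * Real.pi) ^ (-(n : ℝ) / 2) : ℝ) : ℂ) *
        (fun y => ⟪(𝓕⁻ f : 𝓢(E n, V)) y, G y⟫_ℂ) ((2 * Real.pi)⁻¹ • x) := by
    intro x
    have eG : G ((2 * Real.pi)⁻¹ • x) = (𝓕⁻ g) ((2 * Real.pi)⁻¹ • x + a) := by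
      change (𝓕⁻ g) (_ - -a) = _
      rw [sub_neg_eq_add]
    beta_reduce
    rw [coordFT_eq, coordFT_eq, inner_smul_left, inner_smul_right, Complex.conj_ofReal, smul_add,
      ← mul_assoc, eG]
  have h4 := Measure.integral_comp_inv_smul (volume : Measure (E n))
    (fun y => ⟪(𝓕⁻ f : 𝓢(E n, V)) y, G y⟫_ℂ) (2 * Real.pi)
  rw [integral_congr_ae (Eventually.of_forall h2), integral_const_mul, h4, finrank_euclideanSpace_fin,
    abs_of_pos (by positivity), Complex.real_smul, ← mul_assoc, hc, one_mul]
  refine Eq.trans h1.symm (integral_congr_ae (Eventually.of_forall fun p => ?_))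
  have h3 : 𝓕 (𝓕⁻ f) = f := FourierTransform.fourier_fourierInv_eq f
  simp only [innerSL_apply_apply]
  rw [h3, fourier_translate, inner_smul_right, ha, inner_smul_left, real_inner_comm]
  congr 3
  rw [conj_trivial, mul_inv_cancel_left₀ (by positivity)]

lemma integral_inner_coordFT (f g : 𝓢(E n, V)) :
    ∫ x, ⟪coordFT f x, coordFT g x⟫_ℂ = ∫ p, ⟪f p, g p⟫_ℂ := by
  simpa using integral_inner_coordFT_translate f g 0

end coordFT

/-! ### The kernel as the Fourier transform of the energy -/

lemma omega_neg (m : ℝ) (p : E n) : omega m (-p) = omega m p := by simp [omega]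

/-- Fourier inversion writes `φ` as the Fourier integral of `(2π)^{-n} h₀`, to which
`finitePart_omegaTilde` applies. The transform in the statement is `h₀(-p)`; the reflection is
harmless because `ω` is even. -/
theorem finitePart_omegaTilde_schwartz (hn : 1 ≤ n) (m : ℝ) [Fact (0 < m)] (φ : 𝓢(E n, ℂ)) :
    (∀ ε : ℝ, 0 < ε →
      IntegrableOn (fun x : E n => (omegaTilde m x : ℂ) * φ x) {x | ε < ‖x‖}) ∧
    Integrable (fun p : E n => (omega m p : ℂ) *
      ∫ x : E n, Complex.exp (-Complex.I * (contract p x : ℝ)) * φ x) ∧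
    HasFinitePart (fun ε : ℝ => ∫ x in {x : E n | ε < ‖x‖}, (omegaTilde m x : ℂ) * φ x)
      ((((2 * Real.pi) ^ (-(n : ℝ)) : ℝ) : ℂ) * ∫ p : E n, (omega m p : ℂ) *
        ∫ x : E n, Complex.exp (-Complex.I * (contract p x : ℝ)) * φ x) := by
  set c : ℂ := (((2 * Real.pi) ^ (-(n : ℝ)) : ℝ) : ℂ) with hc
  set h₀ : 𝓢(E n, ℂ) := SchwartzMap.compCLMOfContinuousLinearEquiv ℂ (dilation n) (𝓕 φ) with hh₀
  have e₀ : ∀ p : E n, h₀ p = ∫ x : E n, Complex.exp (-Complex.I * (contract (-p) x : ℝ)) * φ x := by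
    intro p
    change (𝓕 φ) ((2 * Real.pi)⁻¹ • p) = _
    rw [SchwartzMap.fourier_coe, Real.fourier_eq']
    refine integral_congr_ae (Eventually.of_forall fun x => ?_)
    beta_reduce
    rw [exp_contract, inner_smul_right, smul_eq_mul, inner_neg_left, real_inner_comm]
    congr 3
    have : Real.pi ≠ 0 := Real.pi_ne_zero
    field_simp
  have e₁ : ∀ x : E n, φ x = ∫ p : E n, Complex.exp (⟪p, x⟫_ℝ * Complex.I) * (c * h₀ p) := by
    intro x
    have h1 : 𝓕⁻ (𝓕 φ) = φ := FourierTransform.fourierInv_fourier_eq φ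
    have h2 : φ x = ∫ v : E n, Complex.exp ((2 * Real.pi * ⟪v, x⟫_ℝ : ℝ) * Complex.I) • (𝓕 φ) v := by
      rw [← Real.fourierInv_eq', ← SchwartzMap.fourierInv_coe, h1]
    have h3 := Measure.integral_comp_inv_smul (volume : Measure (E n)) (fun v : E n =>
      Complex.exp ((2 * Real.pi * ⟪v, x⟫_ℝ : ℝ) * Complex.I) • (𝓕 φ) v) (2 * Real.pi)
    rw [← h2, finrank_euclideanSpace_fin, abs_of_pos (by positivity), Complex.real_smul] at h3
    have h4 : ∀ p : E n, Complex.exp (⟪p, x⟫_ℝ * Complex.I) * (c * h₀ p)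
        = c * (Complex.exp ((2 * Real.pi * ⟪(2 * Real.pi)⁻¹ • p, x⟫_ℝ : ℝ) * Complex.I) •
          (𝓕 φ) ((2 * Real.pi)⁻¹ • p)) := by
      intro p
      rw [real_inner_smul_left, mul_inv_cancel_left₀ (by positivity), smul_eq_mul]
      change _ * (c * (𝓕 φ) ((2 * Real.pi)⁻¹ • p)) = _
      ring
    simp_rw [h4]
    rw [integral_const_mul, h3, hc, ← mul_assoc, ← Complex.ofReal_mul, Real.rpow_neg (by positivity),
      Real.rpow_natCast, inv_mul_cancel₀ (by positivity), Complex.ofReal_one, one_mul]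
  have hi : Integrable fun p : E n => c * h₀ p := h₀.integrable.const_mul c
  have hω₀ : Integrable fun p : E n => (omega m p : ℂ) * h₀ p := by
    refine (SchwartzMap.smulLeftCLM ℂ (fun p : E n => (omega m p : ℂ)) h₀).integrable.congr
      (Eventually.of_forall fun p => ?_)
    exact SchwartzMap.smulLeftCLM_apply_apply (hasTemperateGrowth_omega m) h₀ p
  have hω : Integrable fun p : E n => (omega m p : ℂ) * (c * h₀ p) :=
    (hω₀.const_mul c).congr (Eventually.of_forall fun p => by ring)
  obtain ⟨h1, h2⟩ := finitePart_omegaTilde (Fact.out : 0 < m) hn hi hω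
  simp_rw [← e₁] at h1 h2
  have e₂ : ∀ p : E n, (omega m p : ℂ) *
      ∫ x : E n, Complex.exp (-Complex.I * (contract p x : ℝ)) * φ x
      = (fun p => (omega m p : ℂ) * h₀ p) (-p) := by
    intro p
    beta_reduce
    rw [omega_neg, e₀, neg_neg]
  refine ⟨h1, ?_, ?_⟩
  · simp_rw [e₂]
    exact hω₀.comp_neg
  · simp_rw [e₂]
    rw [integral_neg_eq_self (fun p => (omega m p : ℂ) * h₀ p), ← integral_const_mul]
    have e₃ : (fun p : E n => c * ((omega m p : ℂ) * h₀ p))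
        = fun p => (omega m p : ℂ) * (c * h₀ p) := by
      funext p
      ring
    rw [e₃]
    exact h2

/-! ### The generators in coordinate space -/

lemma HasFinitePart.add {J K : ℝ → ℂ} {a b : ℂ} (hJ : HasFinitePart J a)
    (hK : HasFinitePart K b) : HasFinitePart (fun ε => J ε + K ε) (a + b) := by
  obtain ⟨C, hC⟩ := hJ
  obtain ⟨D, hD⟩ := hK
  exact ⟨C + D, (hC.add hD).congr fun ε => by ring⟩

lemma HasFinitePart.const_mul {J : ℝ → ℂ} {a : ℂ} (c : ℂ) (hJ : HasFinitePart J a) :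
    HasFinitePart (fun ε => c * J ε) (c * a) := by
  obtain ⟨C, hC⟩ := hJ
  exact ⟨c * C, (hC.const_mul c).congr fun ε => by ring⟩

lemma HasFinitePart.congr {J K : ℝ → ℂ} {a : ℂ} (hJ : HasFinitePart J a)
    (h : ∀ ε, 0 < ε → J ε = K ε) : HasFinitePart K a := by
  obtain ⟨C, hC⟩ := hJ
  refine ⟨C, hC.congr' ?_⟩
  filter_upwards [self_mem_nhdsWithin] with ε hε
  rw [h ε hε]

lemma omegaTilde_neg (m : ℝ) (x : E n) : omegaTilde m (-x) = omegaTilde m x := by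
  simp [omegaTilde]

/-! ### Pairings of vector-valued Schwartz maps. -/

section pairing

variable {V : Type*} [NormedAddCommGroup V] [InnerProductSpace ℂ V]

lemma lineDerivOp_smulLeftCLM {a : E n → ℝ}
    (ha : Function.HasTemperateGrowth fun p => (a p : ℂ)) (g : 𝓢(E n, V)) {a' : E n →L[ℝ] ℝ}
    {p : E n} (h : HasFDerivAt a a' p) (v : E n) :
    ∂_{v} (SchwartzMap.smulLeftCLM V (fun p => (a p : ℂ)) g) p
      = (a p : ℂ) • ∂_{v} g p + (a' v : ℂ) • g p := by
  have e : (SchwartzMap.smulLeftCLM V (fun p => (a p : ℂ)) g : E n → V) = fun q => a q • g q := by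
    funext q
    rw [SchwartzMap.smulLeftCLM_apply_apply ha, Complex.coe_smul]
  have h2 : HasFDerivAt (fun q => a q • g q) _ p := h.smul (g.hasFDerivAt p)
  change fderiv ℝ (SchwartzMap.smulLeftCLM V (fun p => (a p : ℂ)) g) p v = _
  rw [e, h2.fderiv]
  simp [SchwartzMap.lineDerivOp_apply_eq_fderiv]

/-- Integration by parts against the inner product. -/
lemma integral_inner_lineDerivOp_left (f g : 𝓢(E n, V)) (v : E n) :
    ∫ p, ⟪∂_{v} f p, g p⟫_ℂ = -∫ p, ⟪f p, ∂_{v} g p⟫_ℂ := by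
  have h := SchwartzMap.integral_bilinear_lineDerivOp_right_eq_neg_left (μ := volume) f g
    (isBoundedBilinearMap_inner (𝕜 := ℂ) (E := V)).toContinuousLinearMap v
  rw [eq_comm, neg_eq_iff_eq_neg]
  exact h

lemma integrable_omega_mul_inner (m : ℝ) [Fact (0 < m)] (f g : 𝓢(E n, V)) :
    Integrable fun p => (omega m p : ℂ) * ⟪f p, g p⟫_ℂ := by
  refine (integrable_inner_schwartz f
    (SchwartzMap.smulLeftCLM V (fun p : E n => (omega m p : ℂ)) g)).congr
    (Eventually.of_forall fun p => ?_)
  beta_reduce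
  rw [SchwartzMap.smulLeftCLM_apply_apply (hasTemperateGrowth_omega m), inner_smul_right]

/-- In the variables `x` and `u = y - x` the majorant is a product: `f` is integrable in `x`, the
truncated kernel in `u`, and `g` is bounded. -/
lemma integrable_omegaTilde_mul_inner {m : ℝ} (hm : 0 < m) (f g : 𝓢(E n, V)) {ε : ℝ}
    (hε : 0 < ε) :
    Integrable (fun z : E n × E n => (omegaTilde m z.2 : ℂ) * ⟪f z.1, g (z.1 + z.2)⟫_ℂ)
      (volume.prod (volume.restrict {u | ε < ‖u‖})) := by
  obtain ⟨C, -, hC⟩ := g.decay 0 0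
  have hC : ∀ x, ‖g x‖ ≤ C := fun x => by simpa using hC x
  have hC0 : 0 ≤ C := (norm_nonneg _).trans (hC 0)
  have hb : Integrable (fun z : E n × E n => ‖f z.1‖ * (subordKernel m z.2 * C))
      (volume.prod (volume.restrict {u | ε < ‖u‖})) :=
    f.integrable.norm.mul_prod ((integrableOn_subordKernel m hε).mul_const C)
  have hi : Integrable (fun z : E n × E n =>
      ((-subordKernel m z.2 : ℝ) : ℂ) * ⟪f z.1, g (z.1 + z.2)⟫_ℂ)
      (volume.prod (volume.restrict {u | ε < ‖u‖})) := by
    refine hb.mono' ?_ (Eventually.of_forall fun z => ?_)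
    · have h1 : Measurable fun z : E n × E n => ((-subordKernel m z.2 : ℝ) : ℂ) :=
        Complex.measurable_ofReal.comp ((measurable_subordKernel m).comp measurable_snd).neg
      have h2 : Continuous fun z : E n × E n => ⟪f z.1, g (z.1 + z.2)⟫_ℂ :=
        (f.continuous.comp continuous_fst).inner
          (g.continuous.comp (continuous_fst.add continuous_snd))
      exact h1.aestronglyMeasurable.mul h2.aestronglyMeasurable
    · have h0 := subordKernel_nonneg m z.2
      rw [norm_mul, Complex.norm_real, norm_neg, Real.norm_of_nonneg h0]
      calc subordKernel m z.2 * ‖⟪f z.1, g (z.1 + z.2)⟫_ℂ‖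
          ≤ subordKernel m z.2 * (‖f z.1‖ * C) := by
            gcongr
            exact (norm_inner_le_norm _ _).trans (by gcongr; exact hC _)
        _ = _ := by ring
  refine hi.congr ?_
  have hae : ∀ᵐ z : E n × E n ∂(volume.prod (volume.restrict {u | ε < ‖u‖})), ε < ‖z.2‖ :=
    Measure.quasiMeasurePreserving_snd.ae (ae_restrict_mem (measurableSet_lt_norm ε))
  filter_upwards [hae] with z hz
  rw [omegaTilde_eq hm (norm_pos_iff.1 (hε.trans hz))]

/-- The boost generator acting on functions of the momentum is symmetric up to the
symmetrization of `x_j ω̃`. -/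
lemma integral_boost_symmetrize (m : ℝ) [Fact (0 < m)] (j : Fin n) (f g : 𝓢(E n, V)) :
    -(1 / 2 : ℂ) * (∫ p, (omega m p : ℂ) *
        ⟪(Complex.I • ∂_{(EuclideanSpace.single j 1 : E n)} f) p, g p⟫_ℂ)
      + -(1 / 2 : ℂ) * (∫ p, (omega m p : ℂ) *
        ⟪f p, (Complex.I • ∂_{(EuclideanSpace.single j 1 : E n)} g) p⟫_ℂ)
      = Complex.I * ∫ p, ⟪f p, ((covComp p j / (2 * omega m p) : ℝ) : ℂ) • g p
        - ((omega m p : ℝ) : ℂ) • partialDeriv j g p⟫_ℂ := by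
  set v : E n := EuclideanSpace.single j 1 with hv
  set G : 𝓢(E n, V) := SchwartzMap.smulLeftCLM V (fun p : E n => (omega m p : ℂ)) g
  have hG : ∀ p, G p = (omega m p : ℂ) • g p :=
    SchwartzMap.smulLeftCLM_apply_apply (hasTemperateGrowth_omega m) g
  have hdG : ∀ p, ∂_{v} G p = (omega m p : ℂ) • ∂_{v} g p + ((p j / omega m p : ℝ) : ℂ) • g p := by
    intro p
    rw [lineDerivOp_smulLeftCLM (hasTemperateGrowth_omega m) g (hasFDerivAt_omega m p)]
    congr 3
    simp [hv, EuclideanSpace.inner_single_right, div_eq_inv_mul]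
  -- Moving the derivative off `f` makes it act on `ω g`; half of the extra `p^j/ω` is the term
  -- `p_j/(2ω)` up to the sign from lowering the index.
  have e1 : ∫ p, (omega m p : ℂ) * ⟪(Complex.I • ∂_{v} f) p, g p⟫_ℂ
      = Complex.I * ∫ p, ⟪f p, ∂_{v} G p⟫_ℂ := by
    have h := integral_inner_lineDerivOp_left f G v
    rw [eq_neg_iff_add_eq_zero, add_comm, ← eq_neg_iff_add_eq_zero] at h
    rw [h, ← integral_neg, ← integral_const_mul]
    refine integral_congr_ae (Eventually.of_forall fun p => ?_)
    beta_reduce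
    rw [smul_apply, inner_smul_left, Complex.conj_I, hG, inner_smul_right]
    ring
  have e2 : ∫ p, (omega m p : ℂ) * ⟪f p, (Complex.I • ∂_{v} g) p⟫_ℂ
      = Complex.I * ∫ p, (omega m p : ℂ) * ⟪f p, ∂_{v} g p⟫_ℂ := by
    rw [← integral_const_mul]
    refine integral_congr_ae (Eventually.of_forall fun p => ?_)
    beta_reduce
    rw [smul_apply, inner_smul_right]
    ring
  rw [e1, e2, mul_left_comm, mul_left_comm _ Complex.I, ← mul_add, ← integral_const_mul,
    ← integral_const_mul, ← integral_add ((integrable_inner_schwartz f _).const_mul _)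
      ((integrable_omega_mul_inner m f _).const_mul _)]
  congr 1
  refine integral_congr_ae (Eventually.of_forall fun p => ?_)
  beta_reduce
  have hp : (omega m p : ℂ) ≠ 0 := by exact_mod_cast (omega_pos (Fact.out : 0 < m) p).ne'
  rw [hdG, partialDeriv_schwartz, inner_add_right, inner_sub_right]
  simp only [inner_smul_right, covComp]
  push_cast
  field_simp
  ring

/-- The angular momentum operator commutes with the Fourier transform. -/
lemma exists_rotation_coordFT (i k : Fin n) (g : 𝓢(E n, V)) :
    ∃ G : 𝓢(E n, V),
      (∀ p, G p = ((covComp p i : ℝ) : ℂ) • partialDeriv k g p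
        - ((covComp p k : ℝ) : ℂ) • partialDeriv i g p) ∧
      ∀ x, coordFT G x = ((covComp x i : ℝ) : ℂ) • partialDeriv k (coordFT g) x
        - ((covComp x k : ℝ) : ℂ) • partialDeriv i (coordFT g) x := by
  have hp : ∀ (i k : Fin n) (p : E n),
      ∂_{(EuclideanSpace.single i 1 : E n)} (mulCoord k g) p
        = ((p k : ℝ) : ℂ) • partialDeriv i g p + (if k = i then (1 : ℂ) else 0) • g p := by
    intro i k p
    refine (lineDerivOp_smulLeftCLM (hasTemperateGrowth_coord k) g
      (EuclideanSpace.proj k : E n →L[ℝ] ℝ).hasFDerivAt (EuclideanSpace.single i 1)).trans ?_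
    rw [partialDeriv_schwartz]
    congr 2
    by_cases h : k = i <;> simp [h]
  have hx : ∀ (i k : Fin n) (x : E n), ((covComp x i : ℝ) : ℂ) • partialDeriv k (coordFT g) x
      = coordFT (∂_{(EuclideanSpace.single i 1 : E n)} (mulCoord k g)) x := by
    intro i k x
    rw [partialDeriv_schwartz, lineDerivOp_coordFT, covComp, Complex.ofReal_neg, neg_smul,
      coord_smul_coordFT, LineDeriv.lineDerivOp_smul, smul_smul, Complex.I_mul_I, coordFT_smul,
      smul_apply, neg_one_smul, neg_neg]
  -- Differentiating after multiplying adds a term `δ_{ik} g`, symmetric in `i` and `k`, which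
  -- cancels in the difference; this order is the one the Fourier transform produces.
  refine ⟨∂_{(EuclideanSpace.single i 1 : E n)} (mulCoord k g)
    - ∂_{(EuclideanSpace.single k 1 : E n)} (mulCoord i g), fun p => ?_, fun x => ?_⟩
  · rw [sub_apply, hp, hp]
    simp only [covComp, Complex.ofReal_neg, neg_smul, @eq_comm _ i k]
    abel
  · rw [hx, hx, coordFT_sub, sub_apply]

variable [CompleteSpace V]

/-- In coordinate space the multiplication by the energy is the integral operator with
kernel `ω̃`. -/
theorem finitePart_omegaTilde_pairing (hn : 1 ≤ n) (m : ℝ) [Fact (0 < m)] (f g : 𝓢(E n, V)) :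
    (∀ ε : ℝ, 0 < ε → IntegrableOn (fun z : E n × E n =>
      (omegaTilde m (z.1 - z.2) : ℂ) * ⟪coordFT f z.1, coordFT g z.2⟫_ℂ) {z | ε < ‖z.1 - z.2‖}) ∧
    HasFinitePart (fun ε : ℝ => ∫ z in {z : E n × E n | ε < ‖z.1 - z.2‖},
      (omegaTilde m (z.1 - z.2) : ℂ) * ⟪coordFT f z.1, coordFT g z.2⟫_ℂ)
      (∫ p, (omega m p : ℂ) * ⟪f p, g p⟫_ℂ) := by
  have hm : 0 < m := Fact.out
  set F : E n × E n → ℂ := fun z =>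
    (omegaTilde m (z.1 - z.2) : ℂ) * ⟪coordFT f z.1, coordFT g z.2⟫_ℂ with hF
  -- The shear `(x, u) ↦ (x, x + u)` turns the region off the diagonal into a product and the kernel
  -- into a function of `u` alone, since `ω̃` is even.
  have hmp : MeasurePreserving (fun z : E n × E n => (z.1, z.1 + z.2)) volume volume :=
    measurePreserving_prod_add volume volume
  have he : MeasurableEmbedding (fun z : E n × E n => (z.1, z.1 + z.2)) :=
    (MeasurableEquiv.shearAddRight (E n)).measurableEmbedding
  have hpre : ∀ ε : ℝ, (fun z : E n × E n => (z.1, z.1 + z.2)) ⁻¹' {z | ε < ‖z.1 - z.2‖}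
      = Set.univ ×ˢ {u | ε < ‖u‖} := by
    intro ε
    ext z
    simp
  have hFc : F ∘ (fun z : E n × E n => (z.1, z.1 + z.2)) = fun z =>
      (omegaTilde m z.2 : ℂ) * ⟪coordFT f z.1, coordFT g (z.1 + z.2)⟫_ℂ := by
    funext z
    simp [hF, omegaTilde_neg]
  have hvol : ∀ ε : ℝ, (volume : Measure (E n × E n)).restrict (Set.univ ×ˢ {u | ε < ‖u‖})
      = (volume : Measure (E n)).prod (volume.restrict {u | ε < ‖u‖}) := by
    intro ε
    rw [Measure.volume_eq_prod, ← Measure.prod_restrict, Measure.restrict_univ]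
  have hi := fun ε (hε : 0 < ε) => integrable_omegaTilde_mul_inner hm (coordFT f) (coordFT g) hε
  refine ⟨fun ε hε => ?_, ?_⟩
  · rw [← hmp.integrableOn_comp_preimage he, hpre, hFc, IntegrableOn, hvol]
    exact hi ε hε
  · refine (finitePart_omegaTilde hm hn (integrable_inner_schwartz f g)
      (integrable_omega_mul_inner m f g)).2.congr fun ε hε => ?_
    rw [← hmp.setIntegral_preimage_emb he, hpre, hvol]
    refine Eq.trans ?_ (integral_congr_ae (Eventually.of_forall fun z => (congrFun hFc z).symm))
    -- Integrating over `x` at fixed `u` leaves the translated Plancherel integral, a Fourier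
    -- integral in `u` as `finitePart_omegaTilde` requires.
    rw [integral_prod_symm _ (hi ε hε)]
    refine integral_congr_ae (Eventually.of_forall fun u => ?_)
    exact (integral_inner_coordFT_translate f g u ▸ integral_const_mul _ _).symm

end pairing

/-! ### Matrix elements of the generators in coordinate space. -/

section generators

variable (m : ℝ) [Fact (0 < m)]

lemma annTilde_eq_coordFT (Ψ : SchwartzDomain n) (x : E n) :
    annTilde m x Ψ = coordFT (annSchwartz m Ψ) x := by
  rw [coordFT_apply, annTilde]
  simp_rw [annSchwartz_apply]

lemma integrable_ann (Ψ : SchwartzDomain n) : Integrable fun p : E n => ann m p Ψ := by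
  rw [← coe_annSchwartz]
  exact (annSchwartz m Ψ).integrable

lemma differentiable_ann (Ψ : SchwartzDomain n) : Differentiable ℝ fun p : E n => ann m p Ψ := by
  rw [← coe_annSchwartz]
  exact (annSchwartz m Ψ).differentiable

lemma differentiable_annTilde (Ψ : SchwartzDomain n) :
    Differentiable ℝ fun x : E n => annTilde m x Ψ := by
  simp_rw [annTilde_eq_coordFT]
  exact (coordFT (annSchwartz m Ψ)).differentiable

theorem rotationGenerator_coordinate {i k : Fin n}
    {M : SchwartzDomain n →ₗ[ℂ] SchwartzDomain n} (hM : IsRotationGenerator m i k M)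
    (Φ Ψ : SchwartzDomain n) :
    Integrable (fun x : E n => ⟪annTilde m x Φ,
      ((covComp x i : ℝ) : ℂ) • partialDeriv k (fun y => annTilde m y Ψ) x
        - ((covComp x k : ℝ) : ℂ) • partialDeriv i (fun y => annTilde m y Ψ) x⟫_ℂ) ∧
    ⟪toFock m Φ, toFock m (M Ψ)⟫_ℂ = Complex.I * ∫ x : E n, ⟪annTilde m x Φ,
      ((covComp x i : ℝ) : ℂ) • partialDeriv k (fun y => annTilde m y Ψ) x
        - ((covComp x k : ℝ) : ℂ) • partialDeriv i (fun y => annTilde m y Ψ) x⟫_ℂ := by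
  obtain ⟨G, hG, hG'⟩ := exists_rotation_coordFT i k (annSchwartz m Ψ)
  rw [(hM Φ Ψ).2, ← coe_annSchwartz]
  simp_rw [annTilde_eq_coordFT, ← annSchwartz_apply, ← hG, ← hG']
  exact ⟨integrable_inner_schwartz _ _, by rw [integral_inner_coordFT]⟩

/-- The factor `(x+y)_j` splits: `x^j` is absorbed in `ã(x)Φ` and `y^j` in `ã(y)Ψ`, each as
`i∂/∂p^j` in momentum space. Both halves have finite parts, and `integral_boost_symmetrize` adds
them up to the momentum space formula. -/
theorem boostGenerator_coordinate (hn : 1 ≤ n) {j : Fin n}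
    {M : SchwartzDomain n →ₗ[ℂ] SchwartzDomain n} (hM : IsBoostGenerator m j M)
    (Φ Ψ : SchwartzDomain n) :
    (∀ ε : ℝ, 0 < ε →
      IntegrableOn (fun z : E n × E n =>
        ((covComp (z.1 + z.2) j * omegaTilde m (z.1 - z.2) : ℝ) : ℂ) *
          ⟪annTilde m z.1 Φ, annTilde m z.2 Ψ⟫_ℂ) {z | ε < ‖z.1 - z.2‖}) ∧
    HasFinitePart (fun ε : ℝ => (1 / 2 : ℂ) *
      ∫ z in {z : E n × E n | ε < ‖z.1 - z.2‖},
        ((covComp (z.1 + z.2) j * omegaTilde m (z.1 - z.2) : ℝ) : ℂ) *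
          ⟪annTilde m z.1 Φ, annTilde m z.2 Ψ⟫_ℂ)
      ⟪toFock m Φ, toFock m (M Ψ)⟫_ℂ := by
  set f := annSchwartz m Φ with hf
  set g := annSchwartz m Ψ with hg
  set v : E n := EuclideanSpace.single j 1 with hv
  have hpt : ∀ z : E n × E n, ((covComp (z.1 + z.2) j * omegaTilde m (z.1 - z.2) : ℝ) : ℂ) *
      ⟪annTilde m z.1 Φ, annTilde m z.2 Ψ⟫_ℂ
      = -((omegaTilde m (z.1 - z.2) : ℂ) * ⟪coordFT (Complex.I • ∂_{v} f) z.1, coordFT g z.2⟫_ℂ)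
        + -((omegaTilde m (z.1 - z.2) : ℂ)
          * ⟪coordFT f z.1, coordFT (Complex.I • ∂_{v} g) z.2⟫_ℂ) := by
    intro z
    rw [← coord_smul_coordFT, ← coord_smul_coordFT, inner_smul_left, inner_smul_right,
      Complex.conj_ofReal, annTilde_eq_coordFT, annTilde_eq_coordFT, covComp, PiLp.add_apply]
    push_cast
    ring
  obtain ⟨i1, p1⟩ := finitePart_omegaTilde_pairing hn m (Complex.I • ∂_{v} f) g
  obtain ⟨i2, p2⟩ := finitePart_omegaTilde_pairing hn m f (Complex.I • ∂_{v} g)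
  simp_rw [hpt]
  refine ⟨fun ε hε => (i1 ε hε).neg.add (i2 ε hε).neg, ?_⟩
  rw [(hM Φ Ψ).2, ← coe_annSchwartz]
  simp_rw [← annSchwartz_apply]
  rw [← integral_boost_symmetrize]
  refine ((p1.const_mul _).add (p2.const_mul _)).congr fun ε hε => ?_
  have h := integral_add (i1 ε hε).neg (i2 ε hε).neg
  simp only [Pi.neg_apply, integral_neg] at h
  rw [h]
  ring

end generators

end ScalarField

theorem mainTheorem1 (n : ℕ) (hn : 1 ≤ n) (m : ℝ) [Fact (0 < m)] :
    -- the ladder operators are well defined and differentiable on Schwartz states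
    (∀ Ψ : SchwartzDomain n,
      Integrable (fun p : E n => ann m p Ψ) ∧
      Differentiable ℝ (fun p : E n => ann m p Ψ) ∧
      Differentiable ℝ (fun x : E n => annTilde m x Ψ)) ∧
    -- the formulas in momentum space define operators on the domain of Schwartz states
    (∀ j : Fin n, ∃! T : SchwartzDomain n →ₗ[ℂ] SchwartzDomain n, IsBoostGenerator m j T) ∧
    (∀ i k : Fin n, ∃! T : SchwartzDomain n →ₗ[ℂ] SchwartzDomain n,
      IsRotationGenerator m i k T) ∧
    -- the kernel is the Fourier transform `(2π)^{-n} ∫ dⁿp ω_p e^{-i p_k x^k}` of the energy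
    (∀ φ : 𝓢(E n, ℂ),
      (∀ ε : ℝ, 0 < ε →
        IntegrableOn (fun x : E n => (omegaTilde m x : ℂ) * φ x) {x | ε < ‖x‖}) ∧
      Integrable (fun p : E n => (omega m p : ℂ) *
        ∫ x : E n, Complex.exp (-Complex.I * (contract p x : ℝ)) * φ x) ∧
      HasFinitePart (fun ε : ℝ => ∫ x in {x : E n | ε < ‖x‖}, (omegaTilde m x : ℂ) * φ x)
        ((((2 * Real.pi) ^ (-(n : ℝ)) : ℝ) : ℂ) * ∫ p : E n, (omega m p : ℂ) *
          ∫ x : E n, Complex.exp (-Complex.I * (contract p x : ℝ)) * φ x)) ∧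
    -- `M_{j0} = ½ ∬ dⁿx dⁿy (x + y)_j ω̃(x - y) ã*(x) ã(y)`
    (∀ (j : Fin n) (M : SchwartzDomain n →ₗ[ℂ] SchwartzDomain n), IsBoostGenerator m j M →
      ∀ Φ Ψ : SchwartzDomain n,
        (∀ ε : ℝ, 0 < ε →
          IntegrableOn (fun z : E n × E n =>
            ((covComp (z.1 + z.2) j * omegaTilde m (z.1 - z.2) : ℝ) : ℂ) *
              ⟪annTilde m z.1 Φ, annTilde m z.2 Ψ⟫_ℂ) {z | ε < ‖z.1 - z.2‖}) ∧
        HasFinitePart (fun ε : ℝ => (1 / 2 : ℂ) *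
          ∫ z in {z : E n × E n | ε < ‖z.1 - z.2‖},
            ((covComp (z.1 + z.2) j * omegaTilde m (z.1 - z.2) : ℝ) : ℂ) *
              ⟪annTilde m z.1 Φ, annTilde m z.2 Ψ⟫_ℂ)
          ⟪toFock m Φ, toFock m (M Ψ)⟫_ℂ) ∧
    -- `M_{ik} = i ∫ dⁿx ã*(x) (x_i ∂/∂x^k - x_k ∂/∂x^i) ã(x)`
    (∀ (i k : Fin n) (M : SchwartzDomain n →ₗ[ℂ] SchwartzDomain n),
      IsRotationGenerator m i k M →
      ∀ Φ Ψ : SchwartzDomain n,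
        Integrable (fun x : E n => ⟪annTilde m x Φ,
          ((covComp x i : ℝ) : ℂ) • partialDeriv k (fun y => annTilde m y Ψ) x
            - ((covComp x k : ℝ) : ℂ) • partialDeriv i (fun y => annTilde m y Ψ) x⟫_ℂ) ∧
        ⟪toFock m Φ, toFock m (M Ψ)⟫_ℂ = Complex.I * ∫ x : E n, ⟪annTilde m x Φ,
          ((covComp x i : ℝ) : ℂ) • partialDeriv k (fun y => annTilde m y Ψ) x
            - ((covComp x k : ℝ) : ℂ) • partialDeriv i (fun y => annTilde m y Ψ) x⟫_ℂ) := by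
  exact ⟨fun Ψ => ⟨integrable_ann m Ψ, differentiable_ann m Ψ, differentiable_annTilde m Ψ⟩,
    existsUnique_boostGenerator m, existsUnique_rotationGenerator m,
    finitePart_omegaTilde_schwartz hn m,
    fun _ _ hM Φ Ψ => boostGenerator_coordinate m hn hM Φ Ψ,
    fun _ _ _ hM Φ Ψ => rotationGenerator_coordinate m hM Φ Ψ⟩
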